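/- Let $s\in(\tfrac12,1)$, $\alpha:=s-\tfrac12$, and let $L_s(\mathbb R)$ be the space of $u\in L^1_{\mathrm{loc}}(\mathbb R)$ (real-valued) with $\int_{\mathbb R}\frac{|u(x)|}{1+|x|^{1+2s}}\,dx<\infty$. For $\phi\in C_c^\infty(\mathbb R)$ put $$(-\Delta)^s\phi(x)=C_s\lim_{\varepsilon\to0^+}\int_{|x-y|\ge\varepsilon}\frac{\phi(x)-\phi(y)}{|x-y|^{1+2s}}\,dy,\qquad C_s=\frac{4^s}{\sqrt\pi}\,\frac{\Gamma(\frac12+s)}{|\Gamma(-s)|}.$$ For $u\in L_s(\mathbb R)$ and $\rho\in L^1(\mathbb R)$, the equation $(-\Delta)^su=\rho$ means that $\int_{\mathbb R}u\,(-\Delta)^s\phi\,dx=\int_{\mathbb R}\rho\,\phi\,dx$ for all $\phi\in C_c^\infty(\mathbb R)$; a solution $u$ of it is called an integral solution if $u(x)=O(|x|^{2s-1})$ as $|x|\to\infty$. Functions are identified when they agree almost everywhere, so identities and bounds for $u$ are understood almost everywhere. (1) Let $K:\mathbb R\to[0,\infty)$ be measurable and even, with $e^{\mu|x|}K\notin L^1(\mathbb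 R)$ for all $\mu>0$. Let $u\in L_s(\mathbb R)$ satisfy $Ke^u\in L^1(\mathbb R)$ and $(-\Delta)^su=Ke^u$. Then $u$ is an integral solution, that is, $u(x)=O(|x|^{2s-1})$ as $|x|\to\infty$. Moreover, with $\rho:=Ke^u$ and $c_\alpha:=-\pi^{-1/2}2^{-2\alpha-1}\frac{\Gamma(-\alpha)}{\Gamma(\alpha+\frac12)}>0$, there is $A\in\mathbb R$ such that $$u(x)=-c_\alpha\int_{\mathbb R}\bigl(|x-y|^{2\alpha}-|y|^{2\alpha}\bigr)\rho(y)\,dy+A ;$$ and whenever $u(x)=-c_\alpha\int_{\mathbb R}(|x-y|^{2\alpha}-|y|^{2\alpha})\rho(y)\,dy+A+Bx$ with $A,B\in\mathbb R$, then $B=0$. (2) In particular, this holds for $K\equiv1$: every $u\in L_s(\mathbb R)$ with $e^u\in L^1(\mathbb R)$ and $(-\Delta)^su=e^u$ satisfies all conclusions of (1) with $\rho=e^u$. -/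

import Mathlib

open MeasureTheory Filter Topology Set
open scoped ContDiff

noncomputable section

/-- Normalization constant of the one-dimensional fractional Laplacian of order `s`. -/
def fracLapConst (s : ℝ) : ℝ :=
  (4 : ℝ) ^ s / Real.sqrt Real.pi * (Real.Gamma (1 / 2 + s) / |Real.Gamma (-s)|)

/-- The fractional Laplacian of a test function, as a principal value singular integral
(the limit exists for every smooth compactly supported `φ` and `s ∈ (0,1)`). -/
def fracLap (s : ℝ) (φ : ℝ → ℝ) (x : ℝ) : ℝ :=
  fracLapConst s *
    limUnder (𝓝[>] (0 : ℝ)) fun ε : ℝ =>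
      ∫ y in {y : ℝ | ε ≤ |x - y|}, (φ x - φ y) / |x - y| ^ (1 + 2 * s)

/-- `u` is a representative of an element of the space `L_s(ℝ)`. -/
def MemLs (s : ℝ) (u : ℝ → ℝ) : Prop :=
  LocallyIntegrable u volume ∧
    Integrable (fun x : ℝ => |u x| / (1 + |x| ^ (1 + 2 * s))) volume

/-- `(-Δ)^s u = ρ` in the sense of distributions on `ℝ`. It is used for `u ∈ L_s(ℝ)` and
`ρ ∈ L¹(ℝ)`, for which both integrals converge absolutely. -/
def SolvesFracLap (s : ℝ) (u ρ : ℝ → ℝ) : Prop :=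
  ∀ φ : ℝ → ℝ, ContDiff ℝ ∞ φ → HasCompactSupport φ →
    ∫ x, u x * fracLap s φ x = ∫ x, ρ x * φ x

/-- `u(x) = O(|x|^β)` as `|x| → ∞`; since `u` stands for a class of functions up to equality
almost everywhere, the bound is required almost everywhere. -/
def AEBigOPow (u : ℝ → ℝ) (β : ℝ) : Prop :=
  ∃ C R : ℝ, 0 < R ∧ ∀ᵐ x : ℝ, R ≤ |x| → |u x| ≤ C * |x| ^ β

/-- `u` is an integral solution of `(-Δ)^s u = ρ`. -/
structure IsIntegralSolution (s : ℝ) (u ρ : ℝ → ℝ) : Prop where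
  memLs : MemLs s u
  integrable_rhs : Integrable ρ volume
  solves : SolvesFracLap s u ρ
  growth : AEBigOPow u (2 * s - 1)

/-- The constant `c_α`, the Green's function of `(-Δ)^s` being `-c_α |x|^(2α)`, `α = s - 1/2`. -/
def greenConst (α : ℝ) : ℝ :=
  -(Real.pi ^ (-(1 / 2) : ℝ) * (2 : ℝ) ^ (-2 * α - 1) *
    (Real.Gamma (-α) / Real.Gamma (α + 1 / 2)))

/-- The potential `-c_α ∫ (|x-y|^(2α) - |y|^(2α)) ρ(y) dy` with `α = s - 1/2`. -/
def greenPotential (s : ℝ) (ρ : ℝ → ℝ) (x : ℝ) : ℝ :=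
  -greenConst (s - 1 / 2) *
    ∫ y, (|x - y| ^ (2 * (s - 1 / 2)) - |y| ^ (2 * (s - 1 / 2))) * ρ y

/-- `u` equals the potential of `ρ` plus the affine function `A + B x`, almost everywhere. -/
def HasAffineRepr (s : ℝ) (u ρ : ℝ → ℝ) (A B : ℝ) : Prop :=
  ∀ᵐ x : ℝ, u x = greenPotential s ρ x + A + B * x

end

/-! Write p = 2s, so 1 < p < 2. On test functions the principal value equals, up to the constant
C_s, the absolutely convergent integral `singLap p φ x` = ∫_0^∞ h^(-1-p) (2φ(x) - φ(x+h) - φ(x-h))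
dh. The argument compares u with the Green potential v of ρ, proves a Liouville theorem for u - v,
and excludes a linear term by integrability.

Fundamental solution. The kernel |z|^(p-1) is the derivative of z|z|^(p-1)/p, an odd function
homogeneous of degree p. Homogeneity makes the singular integral of z|z|^(p-1) equal to M sign z,
and differentiating the sign produces a Dirac mass. The number M = π cot(πp/2) comes from two uses
of Hardy's identity, which reduce it to a Mellin integral evaluated by Beta functions. The
reflection formula matches M with c_α and C_s in `neg_greenConst_mul_fracLapConst`, and Fubini gives
`solvesFracLap_greenPotential`.

Liouville. The difference w = u - v is integrable against (1+|x|)^(-1-p) and annihilates `singLap p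
φ` for every test function φ. Cutting off extends this to smooth f that decay together with two
derivatives. For a test function η take f = |·|^(p-1) * η'': it decays like |x|^(p-3), and its
singular integral is a nonzero multiple of η''. Hence w'' = 0 weakly and w = A + Bx
(`exists_hasAffineRepr`).

Slope. Subadditivity of t ↦ t^(p-1) gives v = O(|x|^(p-1)), which is sublinear. If B ≠ 0, then e^u
is at least a constant times e^(|B||x|/2) on the half-line Bx ≥ 0. Since K is even, integrability of
K e^u would make e^(|B||x|/2) K integrable on the whole line, against the hypothesis. So B = 0, and
the bound on v gives the growth of u. -/

/-! ### Three forms of the Beta integral -/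

theorem integrableOn_and_integral_beta {a b : ℝ} (ha : 0 < a) (hb : 0 < b) :
    IntegrableOn (fun x : ℝ => x ^ (a - 1) * (1 - x) ^ (b - 1)) (Ioo 0 1) ∧
      ∫ x in Ioo (0 : ℝ) 1, x ^ (a - 1) * (1 - x) ^ (b - 1) = ProbabilityTheory.beta a b := by
  have h1 := Complex.betaIntegral_convergent (u := a) (v := b) (by simpa) (by simpa)
  rw [intervalIntegrable_iff_integrableOn_Ioo_of_le (by simp)] at h1
  have e : ∀ x ∈ Ioo (0 : ℝ) 1, ((x : ℂ) ^ ((a : ℂ) - 1) * (1 - (x : ℂ)) ^ ((b : ℂ) - 1)).re =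
      x ^ (a - 1) * (1 - x) ^ (b - 1) := by
    intro x hx
    have h2 : ((x : ℂ) ^ ((a : ℂ) - 1) * (1 - (x : ℂ)) ^ ((b : ℂ) - 1)) =
        ((x ^ (a - 1) * (1 - x) ^ (b - 1) : ℝ) : ℂ) := by
      rw [Complex.ofReal_mul, Complex.ofReal_cpow hx.1.le, Complex.ofReal_cpow (by linarith [hx.2])]
      push_cast; rfl
    rw [h2, Complex.ofReal_re]
  have h3 : IntegrableOn (fun x : ℝ => x ^ (a - 1) * (1 - x) ^ (b - 1)) (Ioo 0 1) :=
    IntegrableOn.congr_fun h1.re e measurableSet_Ioo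
  refine ⟨h3, ?_⟩
  rw [ProbabilityTheory.beta_eq_betaIntegralReal a b ha hb, Complex.betaIntegral,
    intervalIntegral.integral_of_le zero_le_one, integral_Ioc_eq_integral_Ioo,
    ← setIntegral_congr_fun measurableSet_Ioo e]
  exact integral_re h1

theorem integrableOn_and_integral_beta_one_add {b c : ℝ} (hb : 0 < b) (hc : 0 < c) :
    IntegrableOn (fun t : ℝ => t ^ (b - 1) * (1 + t) ^ (-(b + c))) (Ioi 0) ∧
      ∫ t in Ioi (0 : ℝ), t ^ (b - 1) * (1 + t) ^ (-(b + c)) = ProbabilityTheory.beta b c := by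
  have him : (fun x : ℝ => x / (1 - x)) '' Ioo 0 1 = Ioi 0 := by
    ext t
    simp only [mem_image, mem_Ioo, mem_Ioi]
    constructor
    · rintro ⟨x, hx, rfl⟩
      exact div_pos hx.1 (by linarith)
    · intro ht
      refine ⟨t / (1 + t), ⟨by positivity, by rw [div_lt_one (by positivity)]; linarith⟩, ?_⟩
      field_simp; ring
  have hd : ∀ x ∈ Ioo (0 : ℝ) 1, HasDerivWithinAt (fun x : ℝ => x / (1 - x))
      (((1 - x) ^ 2)⁻¹) (Ioo 0 1) x := by
    intro x hx
    have : (1 - x) ≠ 0 := by linarith [hx.2]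
    refine (((hasDerivAt_id' x).fun_div ((hasDerivAt_id' x).const_sub 1) this).congr_deriv
      ?_).hasDerivWithinAt
    field_simp; ring
  have hinj : InjOn (fun x : ℝ => x / (1 - x)) (Ioo 0 1) := by
    intro x hx y hy h
    have hx' : (1 - x) ≠ 0 := by linarith [hx.2]
    have hy' : (1 - y) ≠ 0 := by linarith [hy.2]
    simp only at h
    rw [div_eq_div_iff hx' hy'] at h
    linarith
  have e : ∀ x ∈ Ioo (0 : ℝ) 1, |((1 - x) ^ 2)⁻¹| •
      ((x / (1 - x)) ^ (b - 1) * (1 + x / (1 - x)) ^ (-(b + c))) =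
      x ^ (b - 1) * (1 - x) ^ (c - 1) := by
    intro x hx
    have hx' : 0 < 1 - x := by linarith [hx.2]
    have h1 : 1 + x / (1 - x) = (1 - x)⁻¹ := by field_simp; ring
    rw [h1, abs_of_pos (by positivity), Real.div_rpow hx.1.le hx'.le, Real.inv_rpow hx'.le,
      ← Real.rpow_neg hx'.le, smul_eq_mul, ← Real.rpow_natCast, ← Real.rpow_neg hx'.le,
      div_eq_mul_inv, ← Real.rpow_neg hx'.le]
    calc _ = x ^ (b - 1) * ((1 - x) ^ (-((2 : ℕ) : ℝ)) * (1 - x) ^ (-(b - 1)) *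
          (1 - x) ^ (-(-(b + c)))) := by ring
      _ = _ := by
        rw [← Real.rpow_add hx', ← Real.rpow_add hx']; congr 2; push_cast; ring
  obtain ⟨h1, h2⟩ := integrableOn_and_integral_beta hb hc
  rw [← him]
  constructor
  · rw [integrableOn_image_iff_integrableOn_abs_deriv_smul measurableSet_Ioo hd hinj]
    exact h1.congr_fun (fun x hx => (e x hx).symm) measurableSet_Ioo
  · rw [integral_image_eq_integral_abs_deriv_smul measurableSet_Ioo hd hinj,
      setIntegral_congr_fun measurableSet_Ioo e, h2]

theorem integrableOn_and_integral_beta_sub_one {b c : ℝ} (hb : 0 < b) (hc : 0 < c) :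
    IntegrableOn (fun t : ℝ => t ^ (-(b + c)) * (t - 1) ^ (c - 1)) (Ioi 1) ∧
      ∫ t in Ioi (1 : ℝ), t ^ (-(b + c)) * (t - 1) ^ (c - 1) = ProbabilityTheory.beta b c := by
  have him : (fun x : ℝ => x⁻¹) '' Ioo 0 1 = Ioi 1 := by
    ext t
    simp only [mem_image, mem_Ioo, mem_Ioi]
    constructor
    · rintro ⟨x, hx, rfl⟩
      exact (one_lt_inv₀ hx.1).2 hx.2
    · intro ht
      exact ⟨t⁻¹, ⟨by positivity, inv_lt_one_of_one_lt₀ ht⟩, inv_inv t⟩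
  have hd : ∀ x ∈ Ioo (0 : ℝ) 1, HasDerivWithinAt (fun x : ℝ => x⁻¹)
      (-(x ^ 2)⁻¹) (Ioo 0 1) x := fun x hx => (hasDerivAt_inv hx.1.ne').hasDerivWithinAt
  have hinj : InjOn (fun x : ℝ => x⁻¹) (Ioo 0 1) := fun x _ y _ h => inv_injective h
  have e : ∀ x ∈ Ioo (0 : ℝ) 1, |(-(x ^ 2)⁻¹)| •
      ((x⁻¹) ^ (-(b + c)) * (x⁻¹ - 1) ^ (c - 1)) =
      x ^ (b - 1) * (1 - x) ^ (c - 1) := by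
    intro x hx
    have hx0 : 0 < x := hx.1
    have hx' : 0 < 1 - x := by linarith [hx.2]
    have h1 : x⁻¹ - 1 = (1 - x) / x := by field_simp
    rw [h1, abs_neg, abs_of_pos (by positivity), Real.div_rpow hx'.le hx0.le, Real.inv_rpow hx0.le,
      ← Real.rpow_neg hx0.le, smul_eq_mul, ← Real.rpow_natCast, ← Real.rpow_neg hx0.le,
      div_eq_mul_inv, ← Real.rpow_neg hx0.le]
    calc _ = x ^ (-((2 : ℕ) : ℝ)) * x ^ (-(-(b + c))) * x ^ (-(c - 1)) *
          (1 - x) ^ (c - 1) := by ring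
      _ = _ := by
        rw [← Real.rpow_add hx0, ← Real.rpow_add hx0]; congr 2; push_cast; ring
  obtain ⟨h1, h2⟩ := integrableOn_and_integral_beta hb hc
  rw [← him]
  constructor
  · rw [integrableOn_image_iff_integrableOn_abs_deriv_smul measurableSet_Ioo hd hinj]
    exact h1.congr_fun (fun x hx => (e x hx).symm) measurableSet_Ioo
  · rw [integral_image_eq_integral_abs_deriv_smul measurableSet_Ioo hd hinj,
      setIntegral_congr_fun measurableSet_Ioo e, h2]

/-! ### Hardy's identity for power weights -/

theorem aestronglyMeasurable_of_rpow_mul {g : ℝ → ℝ} {q : ℝ}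
    (hg : AEStronglyMeasurable (fun t => t ^ (-q) * g t) (volume.restrict (Ioi 0))) :
    AEStronglyMeasurable g (volume.restrict (Ioi 0)) := by
  have : AEStronglyMeasurable (fun t : ℝ => t ^ q * (t ^ (-q) * g t)) (volume.restrict (Ioi 0)) :=
    (by fun_prop : Measurable fun t : ℝ => t ^ q).aestronglyMeasurable.mul hg
  refine this.congr ?_
  filter_upwards [ae_restrict_mem measurableSet_Ioi] with t (ht : 0 < t)
  rw [← mul_assoc, ← Real.rpow_add ht]; simp

theorem integrableOn_Ioc_of_rpow_mul {g : ℝ → ℝ} {q : ℝ} (hq : 0 ≤ q)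
    (hg : IntegrableOn (fun t => t ^ (-q) * g t) (Ioi 0)) (h : ℝ) :
    IntegrableOn g (Ioc 0 h) := by
  have h1 : IntegrableOn (fun t : ℝ => t ^ (-q) * g t) (Ioc 0 h) :=
    hg.mono_set Ioc_subset_Ioi_self
  refine (h1.norm.const_mul (h ^ q)).mono'
    ((aestronglyMeasurable_of_rpow_mul hg.1).mono_measure
      (Measure.restrict_mono Ioc_subset_Ioi_self le_rfl)) ?_
  filter_upwards [ae_restrict_mem measurableSet_Ioc] with t ht
  have ht0 : 0 < t := ht.1
  have h2 : g t = t ^ q * (t ^ (-q) * g t) := by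
    rw [← mul_assoc, ← Real.rpow_add ht0]; simp
  rw [h2, norm_mul, Real.norm_of_nonneg (by positivity : (0:ℝ) ≤ t ^ q), ← h2]
  gcongr
  exact ht.2

/-- Hardy's identity for power weights. -/
theorem integrableOn_and_integral_rpow_mul_primitive {g G : ℝ → ℝ} {q : ℝ} (hq : 0 < q)
    (hg : IntegrableOn (fun t => t ^ (-q) * g t) (Ioi 0))
    (hG : ∀ h, 0 < h → G h = ∫ t in Ioc 0 h, g t) :
    IntegrableOn (fun h => h ^ (-1 - q) * G h) (Ioi 0) ∧
      ∫ h in Ioi 0, h ^ (-1 - q) * G h = q⁻¹ * ∫ t in Ioi 0, t ^ (-q) * g t := by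
  -- Fubini on the region t ≤ h, where the h-integral of h^(-1-q) over (t, ∞) is t^(-q)/q.
  set F : ℝ × ℝ → ℝ := fun z => {z : ℝ × ℝ | z.1 ≤ z.2}.indicator
    (fun z => z.2 ^ (-1 - q) * g z.1) z with hF
  have hgm := aestronglyMeasurable_of_rpow_mul hg.1
  -- The free constant c is used twice: with `‖g t‖` for absolute integrability and with `g t` for
  -- the value.
  have hFt : ∀ t, 0 < t → ∀ c : ℝ, IntegrableOn
      (fun h => {z : ℝ × ℝ | z.1 ≤ z.2}.indicator (fun z => z.2 ^ (-1 - q) * c) (t, h)) (Ioi 0) ∧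
      ∫ h in Ioi 0, {z : ℝ × ℝ | z.1 ≤ z.2}.indicator (fun z => z.2 ^ (-1 - q) * c) (t, h) =
        q⁻¹ * (t ^ (-q) * c) := by
    intro t ht c
    have e : (fun h => {z : ℝ × ℝ | z.1 ≤ z.2}.indicator (fun z => z.2 ^ (-1 - q) * c) (t, h)) =
        (Ici t).indicator fun h => h ^ (-1 - q) * c := by
      ext h; simp [indicator]
    have h1 : IntegrableOn (fun h : ℝ => h ^ (-1 - q) * c) (Ioi t) :=
      (integrableOn_Ioi_rpow_of_lt (by linarith) ht).mul_const c
    have e2 : Ioi (0 : ℝ) ∩ Ici t = Ici t := by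
      ext h; simp only [mem_inter_iff, mem_Ioi, mem_Ici]; constructor
      · exact fun h => h.2
      · exact fun h => ⟨by linarith, h⟩
    rw [e]
    constructor
    · rw [← integrableOn_Ici_iff_integrableOn_Ioi] at h1
      exact (h1.integrable_indicator measurableSet_Ici).integrableOn
    · rw [setIntegral_indicator measurableSet_Ici, e2, integral_Ici_eq_integral_Ioi,
        integral_mul_const, integral_Ioi_rpow_of_lt (by linarith) ht]
      have : -1 - q + 1 = -q := by ring
      rw [this]; field_simp
  have hmeas : AEStronglyMeasurable F
      ((volume.restrict (Ioi 0)).prod (volume.restrict (Ioi 0))) := by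
    refine AEStronglyMeasurable.indicator ?_ (measurableSet_le measurable_fst measurable_snd)
    exact ((by fun_prop : Measurable fun z : ℝ × ℝ => z.2 ^ (-1 - q))).aestronglyMeasurable.mul
      hgm.comp_fst
  have hint : Integrable F ((volume.restrict (Ioi 0)).prod (volume.restrict (Ioi 0))) := by
    rw [integrable_prod_iff hmeas]
    constructor
    · filter_upwards [ae_restrict_mem measurableSet_Ioi] with t ht
      exact (hFt t ht (g t)).1
    · refine (hg.norm.const_mul q⁻¹).congr ?_
      filter_upwards [ae_restrict_mem measurableSet_Ioi] with t ht
      have ht' : 0 < t := ht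
      rw [norm_mul, Real.norm_of_nonneg (by positivity : (0:ℝ) ≤ t ^ (-q)), ← (hFt t ht ‖g t‖).2]
      refine setIntegral_congr_fun measurableSet_Ioi fun h hh => ?_
      have hh' : 0 < h := hh
      simp only [hF, indicator]
      split_ifs
      · rw [norm_mul, Real.norm_of_nonneg (by positivity : (0:ℝ) ≤ h ^ (-1 - q))]
      · simp
  have hr : ∀ h ∈ Ioi (0 : ℝ), ∫ t in Ioi 0, F (t, h) = h ^ (-1 - q) * G h := by
    intro h hh
    rw [hG h hh, ← integral_const_mul]
    have e : (fun t => F (t, h)) = (Iic h).indicator fun t => h ^ (-1 - q) * g t := by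
      ext t; simp [hF, indicator]
    rw [e, setIntegral_indicator measurableSet_Iic, Ioi_inter_Iic]
  constructor
  · exact hint.integral_prod_right.congr
      (by filter_upwards [ae_restrict_mem measurableSet_Ioi] with h hh using hr h hh)
  · rw [← setIntegral_congr_fun measurableSet_Ioi hr,
      ← integral_integral_swap (f := fun t h => F (t, h)) hint, ← integral_const_mul]
    exact setIntegral_congr_fun measurableSet_Ioi fun t ht => (hFt t ht (g t)).2

/-! ### A Mellin integral by regularisation -/

/-- Up to the factor `-(p - 1)` with `a = 2 - p`, the derivative of
`t ↦ |1 - t| ^ (p - 1) - |1 + t| ^ (p - 1)`. -/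
noncomputable def signedPowSum (a t : ℝ) : ℝ := Real.sign (1 - t) * |1 - t| ^ (-a) + (1 + t) ^ (-a)

theorem signedPowSum_of_lt_one {a t : ℝ} (ht : t < 1) :
    signedPowSum a t = (1 - t) ^ (-a) + (1 + t) ^ (-a) := by
  rw [signedPowSum, Real.sign_of_pos (by linarith), abs_of_pos (by linarith), one_mul]

theorem signedPowSum_of_one_lt {a t : ℝ} (ht : 1 < t) :
    signedPowSum a t = -(t - 1) ^ (-a) + (1 + t) ^ (-a) := by
  rw [signedPowSum, Real.sign_of_neg (by linarith), abs_of_neg (by linarith), neg_one_mul, neg_sub]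

theorem measurable_real_sign : Measurable Real.sign := by
  unfold Real.sign
  exact Measurable.ite measurableSet_Iio measurable_const
    (Measurable.ite measurableSet_Ioi measurable_const measurable_const)

theorem measurable_signedPowSum (a : ℝ) : Measurable (signedPowSum a) := by
  unfold signedPowSum
  have : Measurable fun t : ℝ => Real.sign (1 - t) := measurable_real_sign.comp (by fun_prop)
  fun_prop

theorem Ioc_zero_one_union_Ioi_one : Ioc (0 : ℝ) 1 ∪ Ioi 1 = Ioi 0 :=
  Ioc_union_Ioi_eq_Ioi zero_le_one

/-- The shift z > 0 makes three pieces converge separately. At z = 0 the term with 1 + t and the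
part beyond t = 1 of the other term both behave like 1/t at infinity, and only their difference is
integrable. -/
theorem integrableOn_and_integral_signedPowSum_shift {a z : ℝ} (ha : a < 1) (hz : 0 < z)
    (hza : z < a) :
    IntegrableOn (fun t => t ^ (a - 1 - z) * signedPowSum a t) (Ioi 0) ∧
      ∫ t in Ioi 0, t ^ (a - 1 - z) * signedPowSum a t =
        ProbabilityTheory.beta (a - z) z + ProbabilityTheory.beta (a - z) (1 - a) -
          ProbabilityTheory.beta z (1 - a) := by
  obtain ⟨i1, e1⟩ := integrableOn_and_integral_beta_one_add (b := a - z) (c := z)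
    (by linarith) hz
  obtain ⟨i2, e2⟩ := integrableOn_and_integral_beta (a := a - z) (b := 1 - a)
    (by linarith) (by linarith)
  obtain ⟨i3, e3⟩ := integrableOn_and_integral_beta_sub_one (b := z) (c := 1 - a)
    hz (by linarith)
  set g : ℝ → ℝ := fun t => t ^ (a - 1 - z) * (Real.sign (1 - t) * |1 - t| ^ (-a)) with hg
  have g1 : ∀ t ∈ Ioo (0 : ℝ) 1, t ^ (a - z - 1) * (1 - t) ^ (1 - a - 1) = g t := by
    intro t ht
    simp only [hg]
    rw [Real.sign_of_pos (by linarith [ht.2]), abs_of_pos (by linarith [ht.2]), one_mul]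
    congr 2 <;> ring
  have g2 : ∀ t ∈ Ioi (1 : ℝ), -(t ^ (-(z + (1 - a))) * (t - 1) ^ (1 - a - 1)) = g t := by
    intro t (ht : 1 < t)
    simp only [hg]
    rw [Real.sign_of_neg (by linarith), abs_of_neg (by linarith), neg_sub, neg_one_mul, mul_neg]
    congr 3 <;> ring
  have j2 : IntegrableOn g (Ioc 0 1) := by
    rw [integrableOn_Ioc_iff_integrableOn_Ioo]
    exact i2.congr_fun g1 measurableSet_Ioo
  have j3 : IntegrableOn g (Ioi 1) := i3.neg.congr_fun g2 measurableSet_Ioi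
  have jg : IntegrableOn g (Ioi 0) := by
    rw [← Ioc_zero_one_union_Ioi_one]; exact j2.union j3
  have eg : ∫ t in Ioi 0, g t =
      ProbabilityTheory.beta (a - z) (1 - a) - ProbabilityTheory.beta z (1 - a) := by
    rw [← Ioc_zero_one_union_Ioi_one, setIntegral_union Ioc_disjoint_Ioi_same measurableSet_Ioi
      j2 j3, integral_Ioc_eq_integral_Ioo, ← setIntegral_congr_fun measurableSet_Ioo g1, e2,
      ← setIntegral_congr_fun measurableSet_Ioi g2, integral_neg, e3]
    ring
  have hsum : ∀ t, t ^ (a - z - 1) * (1 + t) ^ (-(a - z + z)) + g t =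
      t ^ (a - 1 - z) * signedPowSum a t := by
    intro t
    rw [sub_add_cancel, sub_right_comm]
    simp only [hg, signedPowSum]
    ring
  simp_rw [← hsum]
  exact ⟨i1.add jg, by rw [integral_add i1 jg, e1, eg]; ring⟩

/-- Beyond t = 1 the two powers nearly cancel. With r = (t-1)/(1+t) in [0,1] and r ≤ r^a, the
difference is at most (t-1)^(-a) (1 - r), which gains the missing factor 2/t. -/
theorem integrableOn_rpow_mul_signedPowSum {a : ℝ} (ha0 : 0 < a) (ha : a < 1) :
    IntegrableOn (fun t => t ^ (a - 1) * signedPowSum a t) (Ioi 0) := by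
  have hm : Measurable fun t : ℝ => t ^ (a - 1) * signedPowSum a t :=
    (by fun_prop : Measurable fun t : ℝ => t ^ (a - 1)).mul (measurable_signedPowSum a)
  rw [← Ioc_zero_one_union_Ioi_one]
  refine IntegrableOn.union ?_ ?_
  · rw [integrableOn_Ioc_iff_integrableOn_Ioo]
    have i1 := (integrableOn_and_integral_beta ha0 (b := 1 - a) (by linarith)).1
    have i2 : IntegrableOn (fun t : ℝ => t ^ (a - 1)) (Ioo 0 1) :=
      (intervalIntegral.integrableOn_Ioo_rpow_iff zero_lt_one).2 (by linarith)
    refine (i1.add i2).mono' hm.aestronglyMeasurable ?_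
    filter_upwards [ae_restrict_mem measurableSet_Ioo] with t ht
    have h0 : 0 < t := ht.1
    have h1 : 0 < 1 - t := by linarith [ht.2]
    rw [signedPowSum_of_lt_one ht.2, Real.norm_of_nonneg (by positivity), mul_add]
    simp only [Pi.add_apply]
    rw [show 1 - a - 1 = -a by ring]
    gcongr
    calc t ^ (a - 1) * (1 + t) ^ (-a) ≤ t ^ (a - 1) * 1 := by
          gcongr
          exact Real.rpow_le_one_of_one_le_of_nonpos (by linarith) (by linarith)
      _ = _ := mul_one _
  · have i1 := (integrableOn_and_integral_beta_sub_one (b := 1) (c := 1 - a) one_pos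
      (by linarith)).1
    refine (i1.const_mul 2).mono' hm.aestronglyMeasurable ?_
    filter_upwards [ae_restrict_mem measurableSet_Ioi] with t ht
    have ht1 : 1 < t := ht
    have h0 : 0 < t := by linarith
    have h1 : 0 < t - 1 := by linarith
    have hx0 : 0 ≤ (t - 1) / (1 + t) := by positivity
    have hx1 : (t - 1) / (1 + t) ≤ 1 := by rw [div_le_one (by positivity)]; linarith
    have hx : (t - 1) / (1 + t) ≤ ((t - 1) / (1 + t)) ^ a :=
      Real.self_le_rpow_of_le_one hx0 hx1 ha.le
    have hx2 : ((t - 1) / (1 + t)) ^ a ≤ 1 := Real.rpow_le_one hx0 hx1 ha0.le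
    have key : (1 + t) ^ (-a) = (t - 1) ^ (-a) * ((t - 1) / (1 + t)) ^ a := by
      rw [Real.div_rpow h1.le (by positivity), Real.rpow_neg h1.le, Real.rpow_neg (by positivity)]
      field_simp
    rw [signedPowSum_of_one_lt ht1, key, norm_mul, Real.norm_of_nonneg (by positivity :
      (0:ℝ) ≤ t ^ (a - 1))]
    have h2 : ‖-(t - 1) ^ (-a) + (t - 1) ^ (-a) * ((t - 1) / (1 + t)) ^ a‖ ≤
        (t - 1) ^ (-a) * (2 * t⁻¹) := by
      rw [show -(t - 1) ^ (-a) + (t - 1) ^ (-a) * ((t - 1) / (1 + t)) ^ a =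
        -((t - 1) ^ (-a) * (1 - ((t - 1) / (1 + t)) ^ a)) by ring, norm_neg, norm_mul,
        Real.norm_of_nonneg (by positivity), Real.norm_of_nonneg (by linarith)]
      gcongr
      calc 1 - ((t - 1) / (1 + t)) ^ a ≤ 1 - (t - 1) / (1 + t) := by linarith
        _ = 2 / (1 + t) := by field_simp; ring
        _ ≤ 2 / t := by gcongr; linarith
        _ = _ := by ring
    calc _ ≤ t ^ (a - 1) * ((t - 1) ^ (-a) * (2 * t⁻¹)) := by gcongr
      _ = 2 * ((t ^ (a - 1) * t⁻¹) * (t - 1) ^ (-a)) := by ring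
      _ = _ := by
        rw [← Real.rpow_neg_one t, ← Real.rpow_add h0]
        congr 3 <;> ring

/-- The poles of the first and third Beta functions cancel. Their difference is
Γ(1+z)/(Γ(a)Γ(1-a+z)) times the difference quotient at 0 of r(z) = Γ(a-z)Γ(1-a+z) = π/sin(π(a-z)),
so the limit is r'(0)/r(0) plus the limit of the middle term. -/
theorem tendsto_beta_combination {a : ℝ} (ha0 : 0 < a) (ha : a < 1) :
    Tendsto (fun z => ProbabilityTheory.beta (a - z) z + ProbabilityTheory.beta (a - z) (1 - a) -
          ProbabilityTheory.beta z (1 - a)) (𝓝[>] 0)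
      (𝓝 (Real.pi * Real.cos (Real.pi * a) / Real.sin (Real.pi * a) +
        Real.pi / Real.sin (Real.pi * a))) := by
  have hsin : 0 < Real.sin (Real.pi * a) :=
    Real.sin_pos_of_pos_of_lt_pi (by positivity) (by nlinarith [Real.pi_pos])
  have hc : ∀ x, 0 < x → ContinuousAt Real.Gamma x := fun x hx =>
    (Real.differentiableAt_Gamma fun m => by
      have : (0:ℝ) ≤ m := m.cast_nonneg
      linarith).continuousAt
  have hG : ∀ c : ℝ, 0 < c → ∀ σ : ℝ, Tendsto (fun z => Real.Gamma (c + σ * z)) (𝓝[>] 0)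
      (𝓝 (Real.Gamma c)) := by
    intro c hc0 σ
    have : ContinuousAt (fun z => Real.Gamma (c + σ * z)) 0 :=
      ContinuousAt.comp (g := Real.Gamma) (by simpa using hc c hc0) (by fun_prop)
    simpa using this.tendsto.mono_left nhdsWithin_le_nhds
  have hrefl : Real.Gamma a * Real.Gamma (1 - a) = Real.pi / Real.sin (Real.pi * a) :=
    Real.Gamma_mul_Gamma_one_sub a
  have hga := Real.Gamma_pos_of_pos ha0
  have hg1 := Real.Gamma_pos_of_pos (show 0 < 1 - a by linarith)
  set r : ℝ → ℝ := fun z => Real.pi / Real.sin (Real.pi * (a - z)) with hr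
  have hder : HasDerivAt r
      (Real.pi * (Real.pi * Real.cos (Real.pi * a)) / Real.sin (Real.pi * a) ^ 2) 0 := by
    have h1 : HasDerivAt (fun z => Real.sin (Real.pi * (a - z)))
        (Real.cos (Real.pi * (a - 0)) * (Real.pi * (-1))) 0 :=
      (((hasDerivAt_id' (0:ℝ)).const_sub a).const_mul Real.pi).sin
    have := (hasDerivAt_const (0:ℝ) Real.pi).fun_div h1 (by simpa using hsin.ne')
    refine this.congr_deriv ?_
    simp [mul_comm]
  have hslope : Tendsto (fun z => z⁻¹ * (r z - r 0)) (𝓝[>] 0)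
      (𝓝 (Real.pi * (Real.pi * Real.cos (Real.pi * a)) / Real.sin (Real.pi * a) ^ 2)) := by
    have := (hasDerivAt_iff_tendsto_slope_zero.1 hder).mono_left
      (nhdsWithin_mono 0 (s := Ioi 0) (fun x hx => ne_of_gt hx))
    simpa using this
  have hlim := (((hG 1 one_pos 1).div (tendsto_const_nhds.mul (hG (1 - a) (by linarith) 1))
      (mul_pos hga hg1).ne').mul hslope).add
      (((hG a ha0 (-1)).mul_const (Real.Gamma (1 - a))).div (hG 1 one_pos (-1))
        (by simp))
  refine (hlim.congr' ?_).trans (le_of_eq ?_)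
  · filter_upwards [Ioo_mem_nhdsGT ha0] with z hz
    have hz0 : 0 < z := hz.1
    have h1 := Real.Gamma_mul_Gamma_one_sub (a - z)
    have h2 : 0 < Real.Gamma (1 - a + z) := Real.Gamma_pos_of_pos (by linarith [hz.1])
    have h3 : r z = Real.Gamma (a - z) * Real.Gamma (1 - a + z) := by
      rw [hr]; simp only; rw [← h1]; congr 2; ring
    have h4 : r 0 = Real.Gamma a * Real.Gamma (1 - a) := by rw [hrefl]; simp [hr]
    simp only [Pi.div_apply, ProbabilityTheory.beta]
    rw [h3, h4, show 1 + 1 * z = z + 1 by ring, Real.Gamma_add_one hz0.ne',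
      show a + -1 * z = a - z by ring, show 1 + -1 * z = a - z + (1 - a) by ring,
      show 1 - a + 1 * z = 1 - a + z by ring, show a - z + z = a by ring,
      show z + (1 - a) = 1 - a + z by ring]
    field_simp
    ring
  · rw [hrefl, Real.Gamma_one]
    congr 1
    field_simp

theorem integral_rpow_mul_signedPowSum {a : ℝ} (ha0 : 0 < a) (ha : a < 1) :
    ∫ t in Ioi 0, t ^ (a - 1) * signedPowSum a t =
      Real.pi * Real.cos (Real.pi * a) / Real.sin (Real.pi * a) +
        Real.pi / Real.sin (Real.pi * a) := by
  refine tendsto_nhds_unique ?_ (tendsto_beta_combination ha0 ha)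
  -- Majorant for 0 < z < a/2: for t ≤ 1 the power with z = a/2 dominates, for t ≥ 1 the one with z
  -- = 0, so their sum dominates everywhere.
  have hb := (integrableOn_rpow_mul_signedPowSum ha0 ha).norm.add
    (integrableOn_and_integral_signedPowSum_shift ha (half_pos ha0) (half_lt_self ha0)).1.norm
  have hlim : Tendsto (fun z => ∫ t in Ioi 0, t ^ (a - 1 - z) * signedPowSum a t) (𝓝[>] 0)
      (𝓝 (∫ t in Ioi 0, t ^ (a - 1) * signedPowSum a t)) := by
    refine tendsto_integral_filter_of_dominated_convergence _ ?_ ?_ hb ?_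
    · exact Eventually.of_forall fun z => ((by fun_prop : Measurable fun t : ℝ =>
        t ^ (a - 1 - z)).mul (measurable_signedPowSum a)).aestronglyMeasurable
    · filter_upwards [Ioo_mem_nhdsGT (half_pos ha0)] with z hz
      filter_upwards [ae_restrict_mem measurableSet_Ioi] with t ht
      have ht0 : 0 < t := ht
      simp only [Pi.add_apply, norm_mul]
      rw [← add_mul]
      gcongr
      rw [Real.norm_of_nonneg (by positivity), Real.norm_of_nonneg (by positivity),
        Real.norm_of_nonneg (by positivity)]
      have p1 : 0 ≤ t ^ (a - 1) := by positivity
      have p2 : 0 ≤ t ^ (a - 1 - a / 2) := by positivity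
      rcases le_total t 1 with h | h
      · have := Real.rpow_le_rpow_of_exponent_ge ht0 h
          (show a - 1 - a / 2 ≤ a - 1 - z by linarith [hz.2])
        linarith
      · have := Real.rpow_le_rpow_of_exponent_le h (show a - 1 - z ≤ a - 1 by linarith [hz.1])
        linarith
    · filter_upwards [ae_restrict_mem measurableSet_Ioi] with t ht
      have ht0 : 0 < t := ht
      refine Tendsto.mul_const _ ?_
      have : ContinuousAt (fun z => t ^ (a - 1 - z)) 0 :=
        ContinuousAt.rpow continuousAt_const (by fun_prop) (Or.inl ht0.ne')
      simpa using this.tendsto.mono_left nhdsWithin_le_nhds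
  refine hlim.congr' ?_
  filter_upwards [Ioo_mem_nhdsGT ha0] with z hz
  exact (integrableOn_and_integral_signedPowSum_shift ha hz.1 hz.2).2

/-! ### Second differences of the odd power -/

/-- The symmetric second difference, with the sign of the fractional Laplacian. -/
def secondDiff (f : ℝ → ℝ) (x h : ℝ) : ℝ := 2 * f x - f (x + h) - f (x - h)

/-- The odd power function `sign z * |z| ^ p`. -/
noncomputable def oddPow (p z : ℝ) : ℝ := z * |z| ^ (p - 1)

theorem oddPow_of_nonneg {p z : ℝ} (hp : 1 < p) (hz : 0 ≤ z) : oddPow p z = z ^ p := by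
  rw [oddPow, abs_of_nonneg hz]
  rcases hz.eq_or_lt with rfl | h
  · rw [zero_mul, Real.zero_rpow (by linarith)]
  · rw [← Real.rpow_one_add' h.le (by linarith)]; congr 1; ring

theorem oddPow_neg (p z : ℝ) : oddPow p (-z) = -oddPow p z := by
  simp [oddPow]

theorem hasDerivAt_oddPow_of_pos {p z : ℝ} (hp : 1 < p) (hz : 0 < z) :
    HasDerivAt (oddPow p) (p * |z| ^ (p - 1)) z := by
  rw [abs_of_pos hz]
  refine (Real.hasDerivAt_rpow_const (Or.inl hz.ne')).congr_of_eventuallyEq ?_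
  filter_upwards [lt_mem_nhds hz] with y hy
  exact oddPow_of_nonneg hp hy.le

theorem hasDerivAt_oddPow {p : ℝ} (hp : 1 < p) (z : ℝ) :
    HasDerivAt (oddPow p) (p * |z| ^ (p - 1)) z := by
  rcases lt_trichotomy z 0 with hz | rfl | hz
  · have h1 := hasDerivAt_oddPow_of_pos hp (neg_pos.2 hz)
    have h2 := (h1.comp z (hasDerivAt_neg z)).neg
    refine (h2.congr_of_eventuallyEq (Eventually.of_forall fun y => ?_)).congr_deriv (by simp)
    simp [oddPow_neg]
  · rw [abs_zero, Real.zero_rpow (by linarith), mul_zero, hasDerivAt_iff_tendsto_slope_zero]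
    have : ContinuousAt (fun t : ℝ => |t| ^ (p - 1)) 0 :=
      continuous_abs.continuousAt.rpow_const (Or.inr (by linarith))
    have h := this.tendsto.mono_left (nhdsWithin_le_nhds (s := {0}ᶜ))
    rw [abs_zero, Real.zero_rpow (by linarith)] at h
    refine h.congr' ?_
    filter_upwards [self_mem_nhdsWithin] with t ht
    have ht' : t ≠ 0 := ht
    simp [oddPow, ht']
  · exact hasDerivAt_oddPow_of_pos hp hz

theorem continuous_oddPow {p : ℝ} (hp : 1 < p) : Continuous (oddPow p) :=
  continuous_iff_continuousAt.2 fun z => (hasDerivAt_oddPow hp z).continuousAt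

theorem continuous_abs_rpow {q : ℝ} (hq : 0 < q) : Continuous fun z : ℝ => |z| ^ q :=
  continuous_abs.rpow_const fun _ => Or.inr hq.le

theorem hasDerivAt_abs_rpow_of_ne_zero (q : ℝ) {x : ℝ} (hx : x ≠ 0) :
    HasDerivAt (fun y : ℝ => |y| ^ q) (q * (Real.sign x * |x| ^ (q - 1))) x := by
  rcases hx.lt_or_gt with h | h
  · rw [Real.sign_of_neg h]
    refine ((hasDerivAt_abs_neg h).rpow_const (Or.inl (by positivity))).congr_deriv ?_
    ring
  · rw [Real.sign_of_pos h]
    refine ((hasDerivAt_abs_pos h).rpow_const (Or.inl (by positivity))).congr_deriv ?_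
    ring

/-- The second difference is the primitive of p E, and E is the primitive of -(p-1) `signedPowSum (2
- p)`. Two applications of Hardy's identity, with exponents p and p - 1, therefore cancel the
factors p and p - 1 and leave minus the Mellin integral at a = 2 - p. -/
theorem integrableOn_and_integral_secondDiff_oddPow {p : ℝ} (hp : 1 < p) (hp2 : p < 2) :
    IntegrableOn (fun h => h ^ (-1 - p) * secondDiff (oddPow p) 1 h) (Ioi 0) ∧
      ∫ h in Ioi 0, h ^ (-1 - p) * secondDiff (oddPow p) 1 h =
        Real.pi * (Real.cos (Real.pi * (p / 2)) / Real.sin (Real.pi * (p / 2))) := by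
  have ha0 : 0 < 2 - p := by linarith
  have ha1 : 2 - p < 1 := by linarith
  set E : ℝ → ℝ := fun t => |1 - t| ^ (p - 1) - |1 + t| ^ (p - 1) with hE
  have hEc : Continuous E :=
    ((continuous_abs_rpow (by linarith)).comp (by fun_prop)).sub
      ((continuous_abs_rpow (by linarith)).comp (by fun_prop))
  have hw : IntegrableOn (fun t => t ^ (-(p - 1)) * (-(p - 1) * signedPowSum (2 - p) t))
      (Ioi 0) := by
    refine IntegrableOn.congr_fun ((integrableOn_rpow_mul_signedPowSum ha0 ha1).const_mul (-(p - 1)))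
      (fun t _ => ?_) measurableSet_Ioi
    rw [show -(p - 1) = 2 - p - 1 by ring]; ring
  have hEder : ∀ h, 0 < h → E h = ∫ t in Ioc 0 h, -(p - 1) * signedPowSum (2 - p) t := by
    intro h hh
    have hi := integrableOn_Ioc_of_rpow_mul (by linarith : 0 ≤ p - 1) hw h
    -- E is continuous but not differentiable at t = 1, so the fundamental theorem of calculus is
    -- applied away from that point.
    have := integral_eq_of_hasDerivAt_off_countable_of_le E
      (fun t => -(p - 1) * signedPowSum (2 - p) t) hh.le (countable_singleton (1 : ℝ))
      hEc.continuousOn (fun x hx => ?_)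
      ((intervalIntegrable_iff_integrableOn_Ioc_of_le hh.le).2 hi)
    · rw [← intervalIntegral.integral_of_le hh.le, this]; simp [hE]
    · have hx0 : 0 < x := hx.1.1
      have hx1 : (1 - x) ≠ 0 := sub_ne_zero.2 (Ne.symm hx.2)
      have hx2 : (1 + x) ≠ 0 := by positivity
      have d1 := (hasDerivAt_abs_rpow_of_ne_zero (p - 1) hx1).comp x
        ((hasDerivAt_id' x).const_sub 1)
      have d2 := (hasDerivAt_abs_rpow_of_ne_zero (p - 1) hx2).comp x
        ((hasDerivAt_id' x).const_add 1)
      refine (d1.sub d2).congr_deriv ?_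
      rw [Real.sign_of_pos (by positivity : 0 < 1 + x), abs_of_pos (by positivity : 0 < 1 + x),
        signedPowSum, show p - 1 - 1 = -(2 - p) by ring]
      ring
  obtain ⟨i1, e1⟩ := integrableOn_and_integral_rpow_mul_primitive (by linarith) hw hEder
  have hw2 : IntegrableOn (fun t => t ^ (-p) * (p * E t)) (Ioi 0) := by
    refine IntegrableOn.congr_fun (i1.const_mul p) (fun t _ => ?_) measurableSet_Ioi
    rw [show -1 - (p - 1) = -p by ring]; ring
  have hDder : ∀ h, 0 < h → secondDiff (oddPow p) 1 h = ∫ t in Ioc 0 h, p * E t := by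
    intro h hh
    have := intervalIntegral.integral_eq_sub_of_hasDerivAt (a := 0) (b := h)
      (f := secondDiff (oddPow p) 1) (f' := fun t => p * E t) (fun x _ => ?_)
      ((hEc.const_mul p).intervalIntegrable 0 h)
    · rw [← intervalIntegral.integral_of_le hh.le, this]
      have : secondDiff (oddPow p) 1 0 = 0 := by simp [secondDiff]; ring
      rw [this, sub_zero]
    · have d1 := (hasDerivAt_oddPow hp (1 + x)).comp x ((hasDerivAt_id' x).const_add 1)
      have d2 := (hasDerivAt_oddPow hp (1 - x)).comp x ((hasDerivAt_id' x).const_sub 1)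
      refine ((d1.const_sub (2 * oddPow p 1)).sub d2).congr_deriv ?_
      simp only [hE]; ring
  obtain ⟨i2, e2⟩ := integrableOn_and_integral_rpow_mul_primitive (by linarith) hw2 hDder
  refine ⟨i2, ?_⟩
  have e3 : ∫ t in Ioi 0, t ^ (-p) * (p * E t) = p * ∫ t in Ioi 0, t ^ (-1 - (p - 1)) * E t := by
    rw [← integral_const_mul]
    refine setIntegral_congr_fun measurableSet_Ioi (fun t _ => ?_)
    rw [show -1 - (p - 1) = -p by ring]; ring
  have e4 : ∫ t in Ioi 0, t ^ (-(p - 1)) * (-(p - 1) * signedPowSum (2 - p) t) =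
      -(p - 1) * ∫ t in Ioi 0, t ^ (2 - p - 1) * signedPowSum (2 - p) t := by
    rw [← integral_const_mul]
    refine setIntegral_congr_fun measurableSet_Ioi (fun t _ => ?_)
    rw [show -(p - 1) = 2 - p - 1 by ring]; ring
  rw [e2, e3, e1, e4, integral_rpow_mul_signedPowSum ha0 ha1]
  have hs : 0 < Real.sin (Real.pi * (p / 2)) :=
    Real.sin_pos_of_pos_of_lt_pi (by positivity) (by nlinarith [Real.pi_pos])
  have hc : Real.cos (Real.pi * (p / 2)) < 0 :=
    Real.cos_neg_of_pi_div_two_lt_of_lt (by nlinarith [Real.pi_pos]) (by nlinarith [Real.pi_pos])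
  -- Half-angle form: (1 + cos θ)/sin θ = cot(θ/2) at θ = π(2-p), and cot(θ/2) = -cot(πp/2).
  have t1 : Real.pi * (2 - p) = 2 * Real.pi - 2 * (Real.pi * (p / 2)) := by ring
  rw [t1, Real.cos_two_pi_sub, Real.sin_two_pi_sub, Real.cos_two_mul, Real.sin_two_mul]
  have hp1 : p - 1 ≠ 0 := by linarith
  have hp0 : p ≠ 0 := by linarith
  have hc' := hc.ne
  generalize Real.cos (Real.pi * (p / 2)) = c at hc'
  generalize Real.sin (Real.pi * (p / 2)) = σ at hs
  field_simp
  ring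

/-! ### Pairings with second differences and the fundamental solution -/

theorem Continuous.secondDiff {f : ℝ → ℝ} (hf : Continuous f) (h : ℝ) :
    Continuous fun x => secondDiff f x h := by
  unfold _root_.secondDiff; fun_prop

theorem Continuous.secondDiff_uncurry {f : ℝ → ℝ} (hf : Continuous f) :
    Continuous fun z : ℝ × ℝ => _root_.secondDiff f z.1 z.2 := by
  unfold _root_.secondDiff; fun_prop

theorem HasCompactSupport.secondDiff {f : ℝ → ℝ} (hf : HasCompactSupport f) (h : ℝ) :
    HasCompactSupport fun x => secondDiff f x h := by
  have h1 : HasCompactSupport fun x => f (x + h) := hf.comp_homeomorph (Homeomorph.addRight h)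
  have h2 : HasCompactSupport fun x => f (x - h) := hf.comp_homeomorph (Homeomorph.subRight h)
  have h3 : HasCompactSupport fun x => 2 * f x := hf.mul_left
  exact (h3.sub h1).sub h2

theorem hasDerivAt_secondDiff {f f' : ℝ → ℝ} (hf : ∀ x, HasDerivAt f (f' x) x) (h x : ℝ) :
    HasDerivAt (fun x => secondDiff f x h) (secondDiff f' x h) x :=
  (((hf x).const_mul 2).sub ((hf (x + h)).comp_add_const x h)).sub
    ((hf (x - h)).comp_sub_const x h)

theorem integral_two_mul_sub_sub {X : Type*} [MeasurableSpace X] {μ : Measure X} {F G H : X → ℝ}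
    (hF : Integrable F μ) (hG : Integrable G μ) (hH : Integrable H μ) :
    ∫ x, (2 * F x - G x - H x) ∂μ = 2 * (∫ x, F x ∂μ) - (∫ x, G x ∂μ) - ∫ x, H x ∂μ := by
  have h1 : Integrable (fun x => 2 * F x) μ := hF.const_mul 2
  have h2 : Integrable (fun x => 2 * F x - G x) μ := h1.sub hG
  rw [integral_sub h2 hH, integral_sub h1 hG, integral_const_mul]

theorem integral_mul_secondDiff_comm {f g : ℝ → ℝ} (hf : Continuous f) (hfc : HasCompactSupport f)
    (hg : Continuous g) (h : ℝ) :
    ∫ x, g x * secondDiff f x h = ∫ x, f x * secondDiff g x h := by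
  have i : ∀ F G : ℝ → ℝ, Continuous F → Continuous G → HasCompactSupport F →
      Integrable fun x => F x * G x := fun F G hF hG hFc =>
    (hF.mul hG).integrable_of_hasCompactSupport hFc.mul_right
  have c1 : HasCompactSupport fun x => f (x + h) := hfc.comp_homeomorph (Homeomorph.addRight h)
  have c2 : HasCompactSupport fun x => f (x - h) := hfc.comp_homeomorph (Homeomorph.subRight h)
  have i0 := i f g hf hg hfc
  have i1 := i (fun x => f (x + h)) g (by fun_prop) hg c1
  have i2 := i (fun x => f (x - h)) g (by fun_prop) hg c2
  have i3 := i f (fun x => g (x + h)) hf (by fun_prop) hfc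
  have i4 := i f (fun x => g (x - h)) hf (by fun_prop) hfc
  have e1 : ∫ x, f (x + h) * g x = ∫ x, f x * g (x - h) := by
    rw [← integral_sub_right_eq_self (fun x => f (x + h) * g x) h]; simp only [sub_add_cancel]
  have e2 : ∫ x, f (x - h) * g x = ∫ x, f x * g (x + h) := by
    rw [← integral_add_right_eq_self (fun x => f (x - h) * g x) h]; simp only [add_sub_cancel_right]
  calc ∫ x, g x * secondDiff f x h
      = ∫ x, (2 * (f x * g x) - f (x + h) * g x - f (x - h) * g x) := by
        congr 1; ext x; unfold secondDiff; ring
    _ = 2 * (∫ x, f x * g x) - (∫ x, f (x + h) * g x) - ∫ x, f (x - h) * g x := by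
        exact integral_two_mul_sub_sub i0 i1 i2
    _ = 2 * (∫ x, f x * g x) - (∫ x, f x * g (x + h)) - ∫ x, f x * g (x - h) := by
        rw [e1, e2]; ring
    _ = ∫ x, (2 * (f x * g x) - f x * g (x + h) - f x * g (x - h)) := by
        exact (integral_two_mul_sub_sub i0 i3 i4).symm
    _ = _ := by
        congr 1; ext x; unfold secondDiff; ring

/-- Integration by parts replaces |z|^(p-1) by its primitive `oddPow p` divided by p. The gain is
that the h-integral of the second difference of `oddPow p` converges absolutely for every z ≠ 0,
with a value bounded in z. -/
theorem integral_abs_rpow_mul_secondDiff {p : ℝ} (hp : 1 < p) {φ : ℝ → ℝ} (hφ : ContDiff ℝ 1 φ)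
    (hc : HasCompactSupport φ) (h : ℝ) :
    ∫ z, |z| ^ (p - 1) * secondDiff φ z h =
      -p⁻¹ * ∫ z, deriv φ z * secondDiff (oddPow p) z h := by
  have hφ' : Continuous (deriv φ) := hφ.continuous_deriv le_rfl
  have hd : ∀ x, HasDerivAt φ (deriv φ x) x := fun x =>
    (hφ.differentiable one_ne_zero x).hasDerivAt
  have hop := continuous_oddPow hp
  have habs := continuous_abs_rpow (q := p - 1) (by linarith)
  have c1 := hφ.continuous.secondDiff h
  have c2 := hφ'.secondDiff h
  have s1 := hc.secondDiff h
  have s2 := hc.deriv.secondDiff h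
  have key := integral_mul_deriv_eq_deriv_mul_of_integrable (u := fun x => secondDiff φ x h)
    (v := oddPow p) (u' := fun x => secondDiff (deriv φ) x h) (v' := fun z => p * |z| ^ (p - 1))
    (fun x _ => hasDerivAt_secondDiff hd h x) (fun x _ => hasDerivAt_oddPow hp x)
    ((c1.mul (habs.const_mul p)).integrable_of_hasCompactSupport s1.mul_right)
    ((c2.mul hop).integrable_of_hasCompactSupport s2.mul_right)
    ((c1.mul hop).integrable_of_hasCompactSupport s1.mul_right)
  rw [← integral_mul_secondDiff_comm hφ' hc.deriv hop h]
  have e1 : ∫ z, secondDiff φ z h * (p * |z| ^ (p - 1)) =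
      p * ∫ z, |z| ^ (p - 1) * secondDiff φ z h := by
    rw [← integral_const_mul]; congr 1; ext z; ring
  have e2 : ∫ z, secondDiff (deriv φ) z h * oddPow p z =
      ∫ z, oddPow p z * secondDiff (deriv φ) z h := by
    congr 1; ext z; ring
  rw [e1, e2] at key
  have hp0 : p ≠ 0 := by linarith
  field_simp
  linarith

theorem secondDiff_oddPow_neg (p z h : ℝ) :
    secondDiff (oddPow p) (-z) h = -secondDiff (oddPow p) z h := by
  unfold secondDiff
  rw [show -z + h = -(z - h) by ring, show -z - h = -(z + h) by ring]
  simp only [oddPow_neg]; ring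

theorem oddPow_mul {p z x : ℝ} (hz : 0 < z) : oddPow p (z * x) = z ^ p * oddPow p x := by
  have : z ^ p = z * z ^ (p - 1) := by
    rw [Real.rpow_sub_one hz.ne']; field_simp
  rw [oddPow, oddPow, abs_mul, abs_of_pos hz, Real.mul_rpow hz.le (abs_nonneg x), this]
  ring

theorem secondDiff_oddPow_of_pos {p z : ℝ} (hz : 0 < z) (h : ℝ) :
    secondDiff (oddPow p) z h = z ^ p * secondDiff (oddPow p) 1 (z⁻¹ * h) := by
  unfold secondDiff
  have e0 : oddPow p z = z ^ p * oddPow p 1 := by rw [← oddPow_mul hz, mul_one]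
  have e1 : z + h = z * (1 + z⁻¹ * h) := by field_simp
  have e2 : z - h = z * (1 - z⁻¹ * h) := by field_simp
  rw [e0, e1, e2, oddPow_mul hz, oddPow_mul hz]
  ring

theorem rpow_mul_secondDiff_oddPow_of_pos {p z h : ℝ} (hz : 0 < z) (hh : 0 < h) :
    h ^ (-1 - p) * secondDiff (oddPow p) z h =
      z⁻¹ * ((z⁻¹ * h) ^ (-1 - p) * secondDiff (oddPow p) 1 (z⁻¹ * h)) := by
  rw [secondDiff_oddPow_of_pos hz, Real.mul_rpow (by positivity) hh.le, Real.inv_rpow hz.le,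
    ← Real.rpow_neg hz.le]
  have : z ^ p = z⁻¹ * z ^ (-(-1 - p)) := by
    rw [← Real.rpow_neg_one z, ← Real.rpow_add hz]; congr 1; ring
  rw [this]; ring

/-- Homogeneity of degree p matches the weight h^(-1-p) exactly: under h = z t all powers of z
cancel. -/
theorem integral_rpow_mul_comp_secondDiff_oddPow {p z : ℝ} (hp : 1 < p) (hp2 : p < 2)
    (hz : 0 < z) :
    IntegrableOn (fun h => h ^ (-1 - p) * secondDiff (oddPow p) z h) (Ioi 0) ∧
      (∫ h in Ioi 0, h ^ (-1 - p) * secondDiff (oddPow p) z h =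
        ∫ h in Ioi 0, h ^ (-1 - p) * secondDiff (oddPow p) 1 h) ∧
      ∫ h in Ioi 0, ‖h ^ (-1 - p) * secondDiff (oddPow p) z h‖ =
        ∫ h in Ioi 0, ‖h ^ (-1 - p) * secondDiff (oddPow p) 1 h‖ := by
  have hz' : 0 < z⁻¹ := inv_pos.2 hz
  have e : EqOn (fun h => h ^ (-1 - p) * secondDiff (oddPow p) z h) (fun h =>
      z⁻¹ * ((z⁻¹ * h) ^ (-1 - p) * secondDiff (oddPow p) 1 (z⁻¹ * h))) (Ioi 0) :=
    fun h hh => rpow_mul_secondDiff_oddPow_of_pos hz hh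
  have e' : EqOn (fun h => ‖h ^ (-1 - p) * secondDiff (oddPow p) z h‖) (fun h =>
      z⁻¹ * ‖(z⁻¹ * h) ^ (-1 - p) * secondDiff (oddPow p) 1 (z⁻¹ * h)‖) (Ioi 0) := by
    intro h hh
    simp only
    rw [rpow_mul_secondDiff_oddPow_of_pos hz hh, norm_mul, Real.norm_of_nonneg hz'.le]
  refine ⟨?_, ?_, ?_⟩
  · refine IntegrableOn.congr_fun (Integrable.const_mul ?_ z⁻¹) e.symm measurableSet_Ioi
    have := (integrableOn_Ioi_comp_mul_left_iff
      (fun h => h ^ (-1 - p) * secondDiff (oddPow p) 1 h) 0 hz').2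
    rw [mul_zero] at this
    exact this (integrableOn_and_integral_secondDiff_oddPow hp hp2).1
  · rw [setIntegral_congr_fun measurableSet_Ioi e, integral_const_mul,
      integral_comp_mul_left_Ioi (fun h => h ^ (-1 - p) * secondDiff (oddPow p) 1 h) 0 hz']
    simp [hz.ne']
  · rw [setIntegral_congr_fun measurableSet_Ioi e', integral_const_mul,
      integral_comp_mul_left_Ioi (fun h => ‖h ^ (-1 - p) * secondDiff (oddPow p) 1 h‖) 0 hz']
    simp only [mul_zero, smul_eq_mul, inv_inv]
    rw [← mul_assoc, inv_mul_cancel₀ hz.ne', one_mul]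

theorem integrableOn_and_integral_rpow_mul_secondDiff_oddPow {p z : ℝ} (hp : 1 < p) (hp2 : p < 2)
    (hz : z ≠ 0) :
    IntegrableOn (fun h => h ^ (-1 - p) * secondDiff (oddPow p) z h) (Ioi 0) ∧
      (∫ h in Ioi 0, h ^ (-1 - p) * secondDiff (oddPow p) z h =
        Real.sign z * ∫ h in Ioi 0, h ^ (-1 - p) * secondDiff (oddPow p) 1 h) ∧
      ∫ h in Ioi 0, ‖h ^ (-1 - p) * secondDiff (oddPow p) z h‖ =
        ∫ h in Ioi 0, ‖h ^ (-1 - p) * secondDiff (oddPow p) 1 h‖ := by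
  rcases hz.lt_or_gt with h | h
  · obtain ⟨h1, h2, h3⟩ := integral_rpow_mul_comp_secondDiff_oddPow hp hp2 (neg_pos.2 h)
    rw [Real.sign_of_neg h, ← h2, ← h3]
    have e : ∀ x, x ^ (-1 - p) * secondDiff (oddPow p) z x =
        -(x ^ (-1 - p) * secondDiff (oddPow p) (-z) x) := fun x => by
      rw [secondDiff_oddPow_neg]; ring
    simp only [e, norm_neg]
    exact ⟨h1.neg, by rw [integral_neg, neg_one_mul], trivial⟩
  · rw [Real.sign_of_pos h, one_mul]
    exact integral_rpow_mul_comp_secondDiff_oddPow hp hp2 h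

theorem integral_sign_mul_deriv {φ : ℝ → ℝ} (hφ : ContDiff ℝ 1 φ) (hc : HasCompactSupport φ) :
    ∫ z, Real.sign z * deriv φ z = -(2 * φ 0) := by
  have hi : Integrable (deriv φ) :=
    (hφ.continuous_deriv le_rfl).integrable_of_hasCompactSupport hc.deriv
  have hm : Integrable fun z => Real.sign z * deriv φ z := by
    refine hi.norm.mono' (measurable_real_sign.aestronglyMeasurable.mul hi.1)
      (Eventually.of_forall fun z => ?_)
    rw [norm_mul]
    rcases Real.sign_apply_eq z with h | h | h <;> simp [h]
  rw [← intervalIntegral.integral_Iic_add_Ioi hm.integrableOn hm.integrableOn (b := 0),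
    integral_Iic_eq_integral_Iio,
    setIntegral_congr_fun (g := fun z => -deriv φ z) measurableSet_Iio
      (fun z hz => by simp [Real.sign_of_neg hz]),
    setIntegral_congr_fun (g := fun z => deriv φ z) measurableSet_Ioi
      (fun z hz => by simp [Real.sign_of_pos hz]),
    integral_neg, ← integral_Iic_eq_integral_Iio, hc.integral_Iic_deriv_eq hφ,
    hc.integral_Ioi_deriv_eq hφ]
  ring

/-- The potential kernel `|z| ^ (p - 1)` is, up to a constant, a fundamental solution of the
singular integral with kernel `h ^ (-1 - p)`. -/
theorem integral_rpow_mul_integral_abs_rpow_mul_secondDiff {p : ℝ} (hp : 1 < p) (hp2 : p < 2)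
    {φ : ℝ → ℝ} (hφ : ContDiff ℝ 1 φ) (hc : HasCompactSupport φ) :
    ∫ h in Ioi 0, h ^ (-1 - p) * ∫ z, |z| ^ (p - 1) * secondDiff φ z h =
      2 / p * (Real.pi * (Real.cos (Real.pi * (p / 2)) / Real.sin (Real.pi * (p / 2)))) * φ 0 := by
  rw [← (integrableOn_and_integral_secondDiff_oddPow hp hp2).2]
  set M := ∫ h in Ioi 0, h ^ (-1 - p) * secondDiff (oddPow p) 1 h
  set F : ℝ × ℝ → ℝ := fun w => deriv φ w.1 * (w.2 ^ (-1 - p) * secondDiff (oddPow p) w.1 w.2)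
  have hcd := hφ.continuous_deriv le_rfl
  have hi : Integrable (deriv φ) := hcd.integrable_of_hasCompactSupport hc.deriv
  have hne : ∀ᵐ z : ℝ, z ≠ 0 := by simp [ae_iff]
  have hmeas : Measurable F := by
    have h1 := (continuous_oddPow hp).secondDiff_uncurry.measurable
    have h2 := hcd.measurable
    fun_prop
  -- The inner integral of the norm is |φ'(z)| times a number independent of z, so integrability of
  -- φ' suffices for Fubini.
  have hint : Integrable F ((volume : Measure ℝ).prod (volume.restrict (Ioi 0))) := by
    rw [integrable_prod_iff hmeas.aestronglyMeasurable]
    constructor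
    · filter_upwards [hne] with z hz
      exact (integrableOn_and_integral_rpow_mul_secondDiff_oddPow hp hp2 hz).1.const_mul (deriv φ z)
    · refine (hi.norm.mul_const
        (∫ h in Ioi 0, ‖h ^ (-1 - p) * secondDiff (oddPow p) 1 h‖)).congr ?_
      filter_upwards [hne] with z hz
      simp only [F, norm_mul (deriv φ z)]
      rw [integral_const_mul,
        (integrableOn_and_integral_rpow_mul_secondDiff_oddPow hp hp2 hz).2.2]
  calc ∫ h in Ioi 0, h ^ (-1 - p) * ∫ z, |z| ^ (p - 1) * secondDiff φ z h
      = ∫ h in Ioi 0, -p⁻¹ * ∫ z, F (z, h) := by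
        congr 1; ext h
        rw [integral_abs_rpow_mul_secondDiff hp hφ hc, mul_left_comm, ← integral_const_mul]
        congr 2; ext z; simp only [F]; ring
    _ = -p⁻¹ * ∫ z, ∫ h in Ioi 0, F (z, h) := by
        rw [integral_const_mul, integral_integral_swap (f := fun z h => F (z, h)) hint]
    _ = -p⁻¹ * ∫ z, (Real.sign z * deriv φ z) * M := by
        congr 1
        refine integral_congr_ae ?_
        filter_upwards [hne] with z hz
        simp only [F]
        rw [integral_const_mul,
          (integrableOn_and_integral_rpow_mul_secondDiff_oddPow hp hp2 hz).2.1]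
        ring
    _ = _ := by
        rw [integral_mul_const, integral_sign_mul_deriv hφ hc]
        ring

/-! ### Convergence, continuity and decay of the singular integral -/

/-- The singular integral with kernel `h ^ (-1 - p)`: up to a constant, `(-Δ) ^ (p / 2)`. -/
noncomputable def singLap (p : ℝ) (f : ℝ → ℝ) (x : ℝ) : ℝ :=
  ∫ h in Ioi 0, h ^ (-1 - p) * secondDiff f x h

/-- Mean value inequality twice. The bound on f'' is only required within distance h of x, so that
decay of f'' at infinity can be exploited. -/
theorem abs_secondDiff_le {f : ℝ → ℝ} (hf : ContDiff ℝ 2 f) {x h M : ℝ} (hh : 0 ≤ h)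
    (hM : ∀ y, |y - x| ≤ h → |deriv (deriv f) y| ≤ M) : |secondDiff f x h| ≤ 2 * M * h ^ 2 := by
  have hf1 : Differentiable ℝ f := hf.differentiable two_ne_zero
  have hf2 : Differentiable ℝ (deriv f) :=
    ((contDiff_succ_iff_deriv (n := 1)).1 hf).2.2.differentiable one_ne_zero
  have hM0 : 0 ≤ M := (abs_nonneg _).trans (hM x (by simpa using hh))
  have hd : ∀ t, HasDerivAt (fun t => secondDiff f x t) (-deriv f (x + t) + deriv f (x - t)) t := by
    intro t
    have d1 := (hf1 (x + t)).hasDerivAt.comp t ((hasDerivAt_id' t).const_add x)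
    have d2 := (hf1 (x - t)).hasDerivAt.comp t ((hasDerivAt_id' t).const_sub x)
    refine ((d1.const_sub (2 * f x)).sub d2).congr_deriv ?_
    ring
  have hb : ∀ t ∈ Icc 0 h, ‖-deriv f (x + t) + deriv f (x - t)‖ ≤ 2 * M * h := by
    intro t ht
    have h1 := (convex_Icc (x - h) (x + h)).norm_image_sub_le_of_norm_deriv_le (f := deriv f)
      (C := M) (x := x + t) (y := x - t) (fun y _ => hf2 y)
      (fun y hy => hM y (abs_le.2 ⟨by linarith [hy.1], by linarith [hy.2]⟩))
      ⟨by linarith [ht.1], by linarith [ht.2]⟩ ⟨by linarith [ht.2], by linarith [ht.1]⟩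
    rw [neg_add_eq_sub]
    refine h1.trans ?_
    rw [show x - t - (x + t) = -(2 * t) by ring, norm_neg,
      Real.norm_of_nonneg (by linarith [ht.1])]
    nlinarith [ht.2]
  have h2 := (convex_Icc 0 h).norm_image_sub_le_of_norm_hasDerivWithin_le
    (f := fun t => secondDiff f x t) (C := 2 * M * h) (x := 0) (y := h)
    (fun t _ => (hd t).hasDerivWithinAt) hb ⟨le_rfl, hh⟩ ⟨hh, le_rfl⟩
  have h3 : secondDiff f x 0 = 0 := by unfold secondDiff; simp; ring
  simp only [h3, sub_zero, Real.norm_eq_abs, abs_of_nonneg hh] at h2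
  linarith

theorem integrableOn_rpow_mul_min {p : ℝ} (hp : 1 < p) (hp2 : p < 2) :
    IntegrableOn (fun h : ℝ => h ^ (-1 - p) * min (h ^ 2) 1) (Ioi 0) := by
  rw [← Ioc_zero_one_union_Ioi_one]
  refine IntegrableOn.union ?_ ?_
  · have i : IntegrableOn (fun h : ℝ => h ^ (1 - p)) (Ioc 0 1) := by
      rw [integrableOn_Ioc_iff_integrableOn_Ioo]
      exact (intervalIntegral.integrableOn_Ioo_rpow_iff zero_lt_one).2 (by linarith)
    refine i.congr_fun (fun h hh => ?_) measurableSet_Ioc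
    simp only
    rw [min_eq_left (pow_le_one₀ hh.1.le hh.2), ← Real.rpow_natCast, ← Real.rpow_add hh.1]
    congr 1; push_cast; ring
  · refine (integrableOn_Ioi_rpow_of_lt (by linarith : -1 - p < -1) one_pos).congr_fun
      (fun h hh => ?_) measurableSet_Ioi
    have : 1 ≤ h := le_of_lt hh
    simp only
    rw [min_eq_right (one_le_pow₀ this), mul_one]

theorem abs_secondDiff_le_min {f : ℝ → ℝ} (hf : ContDiff ℝ 2 f) {N M : ℝ}
    (hN : ∀ x, |f x| ≤ N) (hM : ∀ x, |deriv (deriv f) x| ≤ M) (x : ℝ) {h : ℝ} (hh : 0 ≤ h) :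
    |secondDiff f x h| ≤ (4 * N + 2 * M) * min (h ^ 2) 1 := by
  have h1 := abs_secondDiff_le hf (x := x) hh (fun y _ => hM y)
  have hN0 : 0 ≤ N := (abs_nonneg _).trans (hN 0)
  have hM0 : 0 ≤ M := (abs_nonneg _).trans (hM 0)
  have h2 : |secondDiff f x h| ≤ 4 * N := by
    unfold secondDiff
    have a := abs_le.1 (hN x)
    have b := abs_le.1 (hN (x + h))
    have c := abs_le.1 (hN (x - h))
    rw [abs_le]; constructor <;> linarith
  rcases le_total (h ^ 2) 1 with h3 | h3
  · rw [min_eq_left h3]; nlinarith [sq_nonneg h]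
  · rw [min_eq_right h3]; linarith

theorem norm_rpow_mul_secondDiff_le {f : ℝ → ℝ} (hf : ContDiff ℝ 2 f) {N M : ℝ}
    (hN : ∀ x, |f x| ≤ N) (hM : ∀ x, |deriv (deriv f) x| ≤ M) (p x : ℝ) {h : ℝ} (hh : 0 < h) :
    ‖h ^ (-1 - p) * secondDiff f x h‖ ≤ (4 * N + 2 * M) * (h ^ (-1 - p) * min (h ^ 2) 1) := by
  rw [norm_mul, Real.norm_of_nonneg (by positivity : (0:ℝ) ≤ h ^ (-1 - p)), Real.norm_eq_abs,
    mul_left_comm]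
  gcongr
  exact abs_secondDiff_le_min hf hN hM x hh.le

theorem measurable_rpow_mul_secondDiff {f : ℝ → ℝ} (hf : Continuous f) (p x : ℝ) :
    Measurable fun h : ℝ => h ^ (-1 - p) * secondDiff f x h := by
  have : Continuous fun h => secondDiff f x h := by unfold secondDiff; fun_prop
  have := this.measurable
  fun_prop

theorem integrableOn_rpow_mul_secondDiff {p : ℝ} (hp : 1 < p) (hp2 : p < 2) {f : ℝ → ℝ}
    (hf : ContDiff ℝ 2 f) {N M : ℝ} (hN : ∀ x, |f x| ≤ N) (hM : ∀ x, |deriv (deriv f) x| ≤ M)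
    (x : ℝ) : IntegrableOn (fun h => h ^ (-1 - p) * secondDiff f x h) (Ioi 0) := by
  refine ((integrableOn_rpow_mul_min hp hp2).const_mul (4 * N + 2 * M)).mono'
    (measurable_rpow_mul_secondDiff hf.continuous p x).aestronglyMeasurable ?_
  filter_upwards [ae_restrict_mem measurableSet_Ioi] with h hh
  exact norm_rpow_mul_secondDiff_le hf hN hM p x hh

theorem tendsto_singLap {p : ℝ} (hp : 1 < p) (hp2 : p < 2) {ι : Type*} {l : Filter ι}
    [l.IsCountablyGenerated] {F : ι → ℝ → ℝ} {f : ℝ → ℝ} {y : ι → ℝ} {x : ℝ} {N M : ℝ}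
    (hF : ∀ᶠ i in l, ContDiff ℝ 2 (F i) ∧ (∀ x, |F i x| ≤ N) ∧ ∀ x, |deriv (deriv (F i)) x| ≤ M)
    (hlim : ∀ h, Tendsto (fun i => secondDiff (F i) (y i) h) l (𝓝 (secondDiff f x h))) :
    Tendsto (fun i => singLap p (F i) (y i)) l (𝓝 (singLap p f x)) := by
  refine tendsto_integral_filter_of_dominated_convergence _ ?_ ?_
    ((integrableOn_rpow_mul_min hp hp2).const_mul (4 * N + 2 * M)) ?_
  · filter_upwards [hF] with i hi
    exact (measurable_rpow_mul_secondDiff hi.1.continuous p _).aestronglyMeasurable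
  · filter_upwards [hF] with i hi
    filter_upwards [ae_restrict_mem measurableSet_Ioi] with h hh
    exact norm_rpow_mul_secondDiff_le hi.1 hi.2.1 hi.2.2 p _ hh
  · exact Eventually.of_forall fun h => (hlim h).const_mul _

theorem continuous_singLap {p : ℝ} (hp : 1 < p) (hp2 : p < 2) {f : ℝ → ℝ}
    (hf : ContDiff ℝ 2 f) {N M : ℝ} (hN : ∀ x, |f x| ≤ N) (hM : ∀ x, |deriv (deriv f) x| ≤ M) :
    Continuous (singLap p f) :=
  continuous_iff_continuousAt.2 fun x =>
    tendsto_singLap hp hp2 (F := fun _ => f) (y := fun y => y)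
      (Eventually.of_forall fun _ => ⟨hf, hN, hM⟩)
      (fun h => (hf.continuous.secondDiff h).tendsto x)

/-- The constant in the decay estimate for `singLap`. -/
noncomputable def singLapDecayConst (p : ℝ) : ℝ := 2 ^ (1 + p) * (2 / (2 - p) + 1 / p + 2)

theorem singLapDecayConst_nonneg {p : ℝ} (hp : 1 < p) (hp2 : p < 2) :
    0 ≤ singLapDecayConst p := by
  have : 0 < 2 - p := by linarith
  unfold singLapDecayConst; positivity

/-- Split at r = (1+|x|)/2. For h ≤ r all points involved satisfy 1 + |y| ≥ r, so f'' is at most A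
r^(-3) there. For h ≥ r the centre term uses the pointwise bound on f, while the translates use the
L¹ bound against h^(-1-p) ≤ r^(-1-p). Both parts are of order r^(-1-p). The result depends on f only
through A, which later gives uniformity along cutoffs. -/
theorem integral_norm_rpow_mul_secondDiff_le {p : ℝ} (hp : 1 < p) (hp2 : p < 2) {f : ℝ → ℝ} (hf : ContDiff ℝ 2 f)
    {A : ℝ} (h0 : ∀ x, |f x| ≤ A * (1 + |x|)⁻¹) (hi : Integrable f) (h1 : ∫ x, |f x| ≤ A)
    (h2 : ∀ x, |deriv (deriv f) x| ≤ A * ((1 + |x|) ^ 3)⁻¹) (x : ℝ) :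
    IntegrableOn (fun h => h ^ (-1 - p) * secondDiff f x h) (Ioi 0) ∧
      ∫ h in Ioi 0, ‖h ^ (-1 - p) * secondDiff f x h‖ ≤
        singLapDecayConst p * A * (1 + |x|) ^ (-1 - p) := by
  set r : ℝ := (1 + |x|) / 2 with hr
  have hr0 : 0 < r := by positivity
  have hA : 0 ≤ A := (integral_nonneg fun x => abs_nonneg (f x)).trans h1
  have hp' : 0 < 2 - p := by linarith
  have hle : ∀ x : ℝ, (1 + |x|)⁻¹ ≤ 1 := fun x =>
    inv_le_one_of_one_le₀ (by linarith [abs_nonneg x])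
  have hle3 : ∀ x : ℝ, ((1 + |x|) ^ 3)⁻¹ ≤ 1 := fun x =>
    inv_le_one_of_one_le₀ (one_le_pow₀ (by linarith [abs_nonneg x]))
  have hI := integrableOn_rpow_mul_secondDiff hp hp2 hf (N := A) (M := A)
    (fun x => (h0 x).trans (mul_le_of_le_one_right hA (hle x)))
    (fun x => (h2 x).trans (mul_le_of_le_one_right hA (hle3 x))) x
  refine ⟨hI, ?_⟩
  have hsplit : ∫ h in Ioi 0, ‖h ^ (-1 - p) * secondDiff f x h‖ =
      (∫ h in Ioc 0 r, ‖h ^ (-1 - p) * secondDiff f x h‖) +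
      ∫ h in Ioi r, ‖h ^ (-1 - p) * secondDiff f x h‖ := by
    rw [← Ioc_union_Ioi_eq_Ioi hr0.le]
    exact setIntegral_union Ioc_disjoint_Ioi_same measurableSet_Ioi
      (IntegrableOn.mono_set hI.norm Ioc_subset_Ioi_self)
      (IntegrableOn.mono_set hI.norm (Ioi_subset_Ioi hr0.le))
  have hnear : ∫ h in Ioc 0 r, ‖h ^ (-1 - p) * secondDiff f x h‖ ≤
      r ^ (-1 - p) * (2 / (2 - p) * A) := by
    have hint : IntegrableOn (fun h : ℝ => h ^ (1 - p)) (Ioc 0 r) := by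
      rw [integrableOn_Ioc_iff_integrableOn_Ioo]
      exact (intervalIntegral.integrableOn_Ioo_rpow_iff hr0).2 (by linarith)
    refine ((Real.le_norm_self _).trans (norm_integral_le_of_norm_le (hint.const_mul (2 * (A * (r ^ 3)⁻¹))) ?_)).trans
      (le_of_eq ?_)
    · filter_upwards [ae_restrict_mem measurableSet_Ioc] with h hh
      have hh0 : 0 < h := hh.1
      have := abs_secondDiff_le hf (x := x) (M := A * (r ^ 3)⁻¹) hh0.le (fun y hy => by
        refine (h2 y).trans ?_
        gcongr
        have := abs_sub_abs_le_abs_sub x y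
        rw [abs_sub_comm] at this
        have := hh.2
        linarith)
      rw [norm_norm, norm_mul, Real.norm_of_nonneg (by positivity : (0:ℝ) ≤ h ^ (-1 - p)),
        Real.norm_eq_abs]
      calc h ^ (-1 - p) * |secondDiff f x h| ≤ h ^ (-1 - p) * (2 * (A * (r ^ 3)⁻¹) * h ^ 2) := by
            gcongr
        _ = 2 * (A * (r ^ 3)⁻¹) * (h ^ (-1 - p) * h ^ (2 : ℝ)) := by
            rw [Real.rpow_two]; ring
        _ = _ := by rw [← Real.rpow_add hh0]; congr 2; ring
    · rw [integral_const_mul, ← intervalIntegral.integral_of_le hr0.le,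
        integral_rpow (Or.inl (by linarith)), Real.zero_rpow (by linarith)]
      have : r ^ (-1 - p) = r ^ (1 - p + 1) * (r ^ 3)⁻¹ := by
        rw [← Real.rpow_natCast, ← Real.rpow_neg hr0.le, ← Real.rpow_add hr0]
        congr 1; push_cast; ring
      rw [this, show 1 - p + 1 = 2 - p by ring]
      field_simp
      ring
  have hfar : ∫ h in Ioi r, ‖h ^ (-1 - p) * secondDiff f x h‖ ≤
      r ^ (-1 - p) * ((1 / p + 2) * A) := by
    have j0 : IntegrableOn (fun h : ℝ => h ^ (-1 - p)) (Ioi r) :=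
      integrableOn_Ioi_rpow_of_lt (by linarith) hr0
    have j1 : Integrable fun h => |f (x + h)| := (hi.comp_add_left x).norm
    have j2 : Integrable fun h => |f (x - h)| := (hi.comp_sub_left x).norm
    have j12 : IntegrableOn (fun h => r ^ (-1 - p) * (|f (x + h)| + |f (x - h)|)) (Ioi r) :=
      ((j1.add j2).const_mul _).integrableOn
    have j00 : IntegrableOn (fun h : ℝ => 2 * |f x| * h ^ (-1 - p)) (Ioi r) := j0.const_mul _
    refine ((Real.le_norm_self _).trans (norm_integral_le_of_norm_le (j00.add j12) ?_)).trans ?_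
    · filter_upwards [ae_restrict_mem measurableSet_Ioi] with h hh
      have hrh : r ≤ h := le_of_lt hh
      have hh0 : 0 < h := hr0.trans_le hrh
      have hmono : h ^ (-1 - p) ≤ r ^ (-1 - p) :=
        Real.rpow_le_rpow_of_nonpos hr0 hrh (by linarith)
      rw [norm_norm, norm_mul, Real.norm_of_nonneg (by positivity : (0:ℝ) ≤ h ^ (-1 - p)),
        Real.norm_eq_abs]
      have hs : |secondDiff f x h| ≤ 2 * |f x| + (|f (x + h)| + |f (x - h)|) := by
        unfold secondDiff
        calc _ ≤ |2 * f x| + |f (x + h)| + |f (x - h)| :=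
              (abs_sub _ _).trans (by gcongr; exact abs_sub _ _)
          _ = _ := by rw [abs_mul, abs_two]; ring
      simp only [Pi.add_apply]
      calc _ ≤ h ^ (-1 - p) * (2 * |f x| + (|f (x + h)| + |f (x - h)|)) := by gcongr
        _ = 2 * |f x| * h ^ (-1 - p) + h ^ (-1 - p) * (|f (x + h)| + |f (x - h)|) := by ring
        _ ≤ _ := by gcongr
    · have e1 : ∫ h, |f (x + h)| ≤ A := by
        rw [integral_add_left_eq_self (fun h => |f h|) x]; exact h1
      have e2 : ∫ h, |f (x - h)| ≤ A := by
        rw [integral_sub_left_eq_self (fun h => |f h|) volume x]; exact h1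
      have e3 : ∫ h in Ioi r, (|f (x + h)| + |f (x - h)|) ≤ A + A := by
        refine (setIntegral_le_integral (j1.add j2)
          (Eventually.of_forall fun h => add_nonneg (abs_nonneg _) (abs_nonneg _))).trans ?_
        have := integral_add j1 j2
        simp only [Pi.add_apply] at this ⊢
        rw [this]; linarith
      have e4 : 2 * |f x| ≤ A * r⁻¹ := by
        have := h0 x
        rw [hr]
        calc 2 * |f x| ≤ 2 * (A * (1 + |x|)⁻¹) := by gcongr
          _ = _ := by field_simp
      simp only [Pi.add_apply]
      rw [integral_add j00 j12, integral_const_mul, integral_const_mul,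
        integral_Ioi_rpow_of_lt (by linarith) hr0, show -1 - p + 1 = -p by ring]
      have e5 : r ^ (-1 - p) = r⁻¹ * r ^ (-p) := by
        rw [← Real.rpow_neg_one r, ← Real.rpow_add hr0]; rfl
      have e6 : -r ^ (-p) / -p = r ^ (-p) / p := by rw [neg_div_neg_eq]
      rw [e6]
      calc _ ≤ A * r⁻¹ * (r ^ (-p) / p) + r ^ (-1 - p) * (A + A) := by gcongr
        _ = _ := by rw [e5]; field_simp; ring
  have hrx : r ^ (-1 - p) = 2 ^ (1 + p) * (1 + |x|) ^ (-1 - p) := by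
    rw [hr, Real.div_rpow (by positivity) (by positivity), div_eq_mul_inv, ← Real.rpow_neg
      (by positivity), mul_comm]
    congr 2; ring
  rw [hsplit]
  refine (add_le_add hnear hfar).trans (le_of_eq ?_)
  rw [hrx, singLapDecayConst]; ring

theorem abs_singLap_le {p : ℝ} (hp : 1 < p) (hp2 : p < 2) {f : ℝ → ℝ} (hf : ContDiff ℝ 2 f)
    {A : ℝ} (h0 : ∀ x, |f x| ≤ A * (1 + |x|)⁻¹) (hi : Integrable f) (h1 : ∫ x, |f x| ≤ A)
    (h2 : ∀ x, |deriv (deriv f) x| ≤ A * ((1 + |x|) ^ 3)⁻¹) (x : ℝ) :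
    |singLap p f x| ≤ singLapDecayConst p * A * (1 + |x|) ^ (-1 - p) :=
  (norm_integral_le_integral_norm _).trans
    (integral_norm_rpow_mul_secondDiff_le hp hp2 hf h0 hi h1 h2 x).2

/-! ### The fractional Laplacian of test functions -/

theorem exists_bound_of_hasCompactSupport {f : ℝ → ℝ} (hf : Continuous f)
    (hc : HasCompactSupport f) : ∃ C, ∀ x, |f x| ≤ C :=
  hf.bounded_above_of_compact_support hc

/-- Folding y = x + h and y = x - h together turns the truncated integral into the integral over h ≥
ε of an absolutely integrable function, so the limit is the full integral. -/
theorem fracLap_eq {s : ℝ} (hs : s ∈ Ioo (1 / 2 : ℝ) 1) {φ : ℝ → ℝ} (hφ : ContDiff ℝ 2 φ)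
    (hc : HasCompactSupport φ) (x : ℝ) :
    fracLap s φ x = fracLapConst s * singLap (2 * s) φ x := by
  have hp : 1 < 2 * s := by linarith [hs.1]
  have hp2 : 2 * s < 2 := by linarith [hs.2]
  have hφ1 : ContDiff ℝ 1 (deriv φ) := ((contDiff_succ_iff_deriv (n := 1)).1 hφ).2.2
  obtain ⟨N, hN⟩ := exists_bound_of_hasCompactSupport hφ.continuous hc
  obtain ⟨M, hM⟩ := exists_bound_of_hasCompactSupport (hφ1.continuous_deriv le_rfl) hc.deriv.deriv
  have hI := integrableOn_rpow_mul_secondDiff hp hp2 hφ hN hM x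
  rw [fracLap]
  congr 1
  refine Tendsto.limUnder_eq ?_
  have hcov := (aecover_Ioi_of_Ici (μ := volume) (A := (0:ℝ)) (l := 𝓝[>] (0 : ℝ))
    (a := fun ε => ε)
    (tendsto_id.mono_left nhdsWithin_le_nhds)).integral_tendsto_of_countably_generated hI
  refine hcov.congr' ?_
  filter_upwards [self_mem_nhdsWithin] with ε hε
  have hε0 : 0 < ε := hε
  -- The truncated integrand recentred at x. Each half-line is integrable separately thanks to the
  -- truncation, which permits the folding.
  set T : ℝ → ℝ := fun h => {h : ℝ | ε ≤ |h|}.indicator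
    (fun h => (φ x - φ (x + h)) / |h| ^ (1 + 2 * s)) h with hT
  have hTm : Measurable T := by
    refine Measurable.indicator ?_ (measurableSet_le measurable_const measurable_abs)
    have := hφ.continuous.measurable
    fun_prop
  have hTpos : IntegrableOn T (Ioi 0) ∧ IntegrableOn (fun h => T (-h)) (Ioi 0) := by
    have j0 : IntegrableOn (fun h : ℝ => 2 * N * h ^ (-1 - 2 * s)) (Ici ε) := by
      rw [integrableOn_Ici_iff_integrableOn_Ioi]
      exact (integrableOn_Ioi_rpow_of_lt (by linarith) hε0).const_mul _
    have j1 : IntegrableOn ((Ici ε).indicator fun h : ℝ => 2 * N * h ^ (-1 - 2 * s)) (Ioi 0) :=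
      (j0.integrable_indicator measurableSet_Ici).integrableOn
    have hb : ∀ h : ℝ, 0 < h → ∀ σ : ℝ, |σ| = h →
        ‖T σ‖ ≤ (Ici ε).indicator (fun h : ℝ => 2 * N * h ^ (-1 - 2 * s)) h := by
      intro h hh σ hσ
      simp only [hT, indicator, mem_ofPred_eq, hσ, mem_Ici]
      split_ifs
      · rw [norm_div, Real.norm_of_nonneg (by positivity : (0:ℝ) ≤ h ^ (1 + 2 * s)),
          div_eq_mul_inv, ← Real.rpow_neg hh.le, show -(1 + 2 * s) = -1 - 2 * s by ring]
        gcongr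
        have a := abs_le.1 (hN x)
        have b := abs_le.1 (hN (x + σ))
        rw [Real.norm_eq_abs, abs_le]; constructor <;> linarith
      · simp
    constructor
    · refine j1.mono' hTm.aestronglyMeasurable ?_
      filter_upwards [ae_restrict_mem measurableSet_Ioi] with h hh
      exact hb h hh h (abs_of_pos hh)
    · refine j1.mono' (hTm.comp measurable_neg).aestronglyMeasurable ?_
      filter_upwards [ae_restrict_mem measurableSet_Ioi] with h hh
      exact hb h hh (-h) (by rw [abs_neg, abs_of_pos hh])
  have hTneg : IntegrableOn T (Iic 0) := by
    rw [integrableOn_Iic_iff_integrableOn_Iio]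
    have := hTpos.2
    rw [← (Measure.measurePreserving_neg (volume : Measure ℝ)).integrableOn_comp_preimage
      (Homeomorph.neg ℝ).measurableEmbedding]
    simpa [Function.comp_def] using this
  symm
  calc ∫ y in {y : ℝ | ε ≤ |x - y|}, (φ x - φ y) / |x - y| ^ (1 + 2 * s)
      = ∫ y, {y : ℝ | ε ≤ |x - y|}.indicator
          (fun y => (φ x - φ y) / |x - y| ^ (1 + 2 * s)) y :=
        (integral_indicator (measurableSet_le measurable_const (by fun_prop))).symm
    _ = ∫ h, T h := by
        rw [← integral_add_left_eq_self _ x]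
        congr 1; ext h
        simp [hT, indicator]
    _ = (∫ h in Ioi 0, T (-h)) + ∫ h in Ioi 0, T h := by
        rw [← intervalIntegral.integral_Iic_add_Ioi hTneg hTpos.1, integral_comp_neg_Ioi, neg_zero]
    _ = ∫ h in Ioi 0, (T (-h) + T h) := (integral_add hTpos.2 hTpos.1).symm
    _ = ∫ h in Ioi 0, (Ici ε).indicator (fun h => h ^ (-1 - 2 * s) * secondDiff φ x h) h := by
        refine setIntegral_congr_fun measurableSet_Ioi fun h hh => ?_
        have hh0 : 0 < h := hh
        simp only [hT, indicator, mem_ofPred_eq, abs_neg, abs_of_pos hh0, mem_Ici]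
        split_ifs
        · rw [div_eq_mul_inv, div_eq_mul_inv, ← Real.rpow_neg hh0.le,
            show -(1 + 2 * s) = -1 - 2 * s by ring, secondDiff, ← sub_eq_add_neg]
          ring
        · simp
    _ = ∫ h in Ici ε, h ^ (-1 - 2 * s) * secondDiff φ x h ∂(volume.restrict (Ioi 0)) :=
        integral_indicator measurableSet_Ici

theorem exists_decay_bounds {φ : ℝ → ℝ} (hφ : ContDiff ℝ 2 φ) (hc : HasCompactSupport φ) :
    ∃ A, (∀ x, |φ x| ≤ A * (1 + |x|)⁻¹) ∧ ∫ x, |φ x| ≤ A ∧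
      ∀ x, |deriv (deriv φ) x| ≤ A * ((1 + |x|) ^ 3)⁻¹ := by
  have hφ1 : ContDiff ℝ 1 (deriv φ) := ((contDiff_succ_iff_deriv (n := 1)).1 hφ).2.2
  have hφ2 : Continuous (deriv (deriv φ)) := hφ1.continuous_deriv le_rfl
  have c0 : Continuous fun x => φ x * (1 + |x|) := hφ.continuous.mul (by fun_prop)
  have c2 : Continuous fun x => deriv (deriv φ) x * (1 + |x|) ^ 3 := hφ2.mul (by fun_prop)
  have s0 : HasCompactSupport fun x => φ x * (1 + |x|) := hc.mul_right
  have s2 : HasCompactSupport fun x => deriv (deriv φ) x * (1 + |x|) ^ 3 :=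
    hc.deriv.deriv.mul_right
  obtain ⟨N, hN⟩ := exists_bound_of_hasCompactSupport c0 s0
  obtain ⟨M, hM⟩ := exists_bound_of_hasCompactSupport c2 s2
  obtain ⟨A, hA⟩ : ∃ A, A = max (max N M) (∫ x, |φ x|) := ⟨_, rfl⟩
  have hNA : N ≤ A := hA ▸ (le_max_left _ _).trans (le_max_left _ _)
  have hMA : M ≤ A := hA ▸ (le_max_right _ _).trans (le_max_left _ _)
  refine ⟨A, fun x => ?_, hA ▸ le_max_right _ _, fun x => ?_⟩
  · have h := hN x
    rw [abs_mul, abs_of_nonneg (by positivity : 0 ≤ 1 + |x|)] at h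
    rw [← div_eq_mul_inv, le_div_iff₀ (by positivity)]
    exact h.trans hNA
  · have h := hM x
    rw [abs_mul, abs_of_nonneg (by positivity : 0 ≤ (1 + |x|) ^ 3)] at h
    rw [← div_eq_mul_inv, le_div_iff₀ (by positivity)]
    exact h.trans hMA

theorem integrable_one_add_abs_rpow_mul_rpow (p : ℝ) :
    Integrable fun x : ℝ => (1 + |x|) ^ (p - 1) * (1 + |x|) ^ (-1 - p) := by
  have := integrable_one_add_norm (E := ℝ) (μ := volume) (r := 2) (by simp)
  refine this.congr (Eventually.of_forall fun x => ?_)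
  simp only [Real.norm_eq_abs]
  rw [← Real.rpow_add (by positivity)]
  congr 1; ring

theorem continuous_singLap_of_hasCompactSupport {p : ℝ} (hp : 1 < p) (hp2 : p < 2) {φ : ℝ → ℝ}
    (hφ : ContDiff ℝ 2 φ) (hc : HasCompactSupport φ) : Continuous (singLap p φ) := by
  have hφ1 : ContDiff ℝ 1 (deriv φ) := ((contDiff_succ_iff_deriv (n := 1)).1 hφ).2.2
  obtain ⟨N, hN⟩ := exists_bound_of_hasCompactSupport hφ.continuous hc
  obtain ⟨M, hM⟩ := exists_bound_of_hasCompactSupport (hφ1.continuous_deriv le_rfl) hc.deriv.deriv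
  exact continuous_singLap hp hp2 hφ hN hM

theorem exists_abs_singLap_le {p : ℝ} (hp : 1 < p) (hp2 : p < 2) {φ : ℝ → ℝ}
    (hφ : ContDiff ℝ 2 φ) (hc : HasCompactSupport φ) :
    ∃ C, 0 ≤ C ∧ ∀ x, |singLap p φ x| ≤ C * (1 + |x|) ^ (-1 - p) := by
  obtain ⟨A, h0, h1, h2⟩ := exists_decay_bounds hφ hc
  have hA : 0 ≤ A := (integral_nonneg fun x => abs_nonneg (φ x)).trans h1
  exact ⟨_, mul_nonneg (singLapDecayConst_nonneg hp hp2) hA, abs_singLap_le hp hp2 hφ h0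
    (hφ.continuous.integrable_of_hasCompactSupport hc) h1 h2⟩

/-- Fubini: growth (1+|x|)^(p-1) against decay (1+|x|)^(-1-p) leaves (1+|x|)^(-2). -/
theorem integral_mul_singLap {p : ℝ} (hp : 1 < p) (hp2 : p < 2) {φ k : ℝ → ℝ}
    (hφ : ContDiff ℝ 2 φ) (hc : HasCompactSupport φ) (hk : Continuous k) {B : ℝ}
    (hB : ∀ x, |k x| ≤ B * (1 + |x|) ^ (p - 1)) :
    ∫ x, k x * singLap p φ x =
      ∫ h in Ioi 0, h ^ (-1 - p) * ∫ x, k x * secondDiff φ x h := by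
  obtain ⟨A, h0, h1, h2⟩ := exists_decay_bounds hφ hc
  have hest := integral_norm_rpow_mul_secondDiff_le hp hp2 hφ h0
    (hφ.continuous.integrable_of_hasCompactSupport hc) h1 h2
  set F : ℝ × ℝ → ℝ := fun w => k w.1 * (w.2 ^ (-1 - p) * secondDiff φ w.1 w.2)
  have hmeas : Measurable F := by
    have h1 := hφ.continuous.secondDiff_uncurry.measurable
    have h2 := hk.measurable
    fun_prop
  have hint : Integrable F ((volume : Measure ℝ).prod (volume.restrict (Ioi 0))) := by
    rw [integrable_prod_iff hmeas.aestronglyMeasurable]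
    refine ⟨Eventually.of_forall fun x => (hest x).1.const_mul (k x), ?_⟩
    refine ((integrable_one_add_abs_rpow_mul_rpow p).const_mul
      (B * (singLapDecayConst p * A))).mono' ?_ (Eventually.of_forall fun x => ?_)
    · exact hmeas.aestronglyMeasurable.norm.integral_prod_right'
    · simp only [F, norm_mul (k x)]
      rw [integral_const_mul, Real.norm_eq_abs, abs_mul, Real.norm_eq_abs, abs_abs,
        abs_of_nonneg (integral_nonneg fun h => norm_nonneg _)]
      calc _ ≤ (B * (1 + |x|) ^ (p - 1)) *
            (singLapDecayConst p * A * (1 + |x|) ^ (-1 - p)) := by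
            gcongr
            · exact (abs_nonneg _).trans (hB x)
            · exact hB x
            · exact (hest x).2
        _ = _ := by ring
  calc ∫ x, k x * singLap p φ x = ∫ x, ∫ h in Ioi 0, F (x, h) := by
        congr 1; ext x; rw [singLap, ← integral_const_mul]
    _ = ∫ h in Ioi 0, ∫ x, F (x, h) := integral_integral_swap (f := fun x h => F (x, h)) hint
    _ = _ := by
        congr 1; ext h
        rw [← integral_const_mul]
        congr 1; ext x; simp only [F]; ring

/-- Second differences annihilate constants. This makes the subtraction of |y|^(p-1) in the Green
kernel harmless. -/
theorem integral_singLap {p : ℝ} (hp : 1 < p) (hp2 : p < 2) {φ : ℝ → ℝ}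
    (hφ : ContDiff ℝ 2 φ) (hc : HasCompactSupport φ) : ∫ x, singLap p φ x = 0 := by
  have := integral_mul_singLap hp hp2 hφ hc (k := fun _ => 1) continuous_const (B := 1)
    (fun x => by
      rw [abs_one, one_mul]
      exact Real.one_le_rpow (by linarith [abs_nonneg x]) (by linarith))
  simp only [one_mul] at this
  rw [this]
  have e : ∀ h, ∫ x, secondDiff φ x h = 0 := by
    intro h
    have := integral_mul_secondDiff_comm hφ.continuous hc (g := fun _ => 1) continuous_const h
    simp only [one_mul] at this
    rw [this]
    have : ∀ x, φ x * secondDiff (fun _ => (1:ℝ)) x h = 0 := fun x => by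
      unfold secondDiff; norm_num
    simp [this]
  simp [e]

/-! ### The translated kernel and the normalising constant -/

theorem abs_sub_rpow_le {q : ℝ} (hq : 0 < q) (x y : ℝ) :
    |x - y| ^ q ≤ (1 + |y|) ^ q * (1 + |x|) ^ q := by
  rw [← Real.mul_rpow (by positivity) (by positivity)]
  gcongr
  have := abs_sub x y
  nlinarith [abs_nonneg x, abs_nonneg y]

theorem secondDiff_comp_add_const (φ : ℝ → ℝ) (y z h : ℝ) :
    secondDiff (fun x => φ (x + y)) z h = secondDiff φ (z + y) h := by
  unfold secondDiff; ring_nf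

theorem integral_abs_sub_rpow_mul_singLap {p : ℝ} (hp : 1 < p) (hp2 : p < 2) {φ : ℝ → ℝ}
    (hφ : ContDiff ℝ 2 φ) (hc : HasCompactSupport φ) (y : ℝ) :
    ∫ x, |x - y| ^ (p - 1) * singLap p φ x =
      2 / p * (Real.pi * (Real.cos (Real.pi * (p / 2)) / Real.sin (Real.pi * (p / 2)))) * φ y := by
  have hq : 0 < p - 1 := by linarith
  rw [integral_mul_singLap hp hp2 hφ hc (k := fun x => |x - y| ^ (p - 1))
    ((continuous_abs_rpow hq).comp (by fun_prop)) (B := (1 + |y|) ^ (p - 1)) (fun x => by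
      rw [abs_of_nonneg (by positivity)]
      exact abs_sub_rpow_le hq x y)]
  have h1 : ContDiff ℝ 1 fun x => φ (x + y) := (hφ.of_le one_le_two).comp (by fun_prop)
  have := integral_rpow_mul_integral_abs_rpow_mul_secondDiff hp hp2 h1
    (hc.comp_homeomorph (Homeomorph.addRight y))
  rw [zero_add] at this
  rw [← this]
  congr 1; ext h; congr 1
  rw [← integral_add_right_eq_self _ y]
  simp only [secondDiff_comp_add_const, add_sub_cancel_right]

/-- The reflection formula at 1/2 + s produces 1/cos(πs) and at s produces 1/sin(πs); these absorb
the cotangent, and |Γ(-s)| = Γ(1-s)/s absorbs the factor 1/s. -/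
theorem neg_greenConst_mul_fracLapConst {s : ℝ} (hs : s ∈ Ioo (1 / 2 : ℝ) 1) :
    -greenConst (s - 1 / 2) * fracLapConst s * (2 / (2 * s) *
      (Real.pi * (Real.cos (Real.pi * (2 * s / 2)) / Real.sin (Real.pi * (2 * s / 2))))) = 1 := by
  have hs0 : 0 < s := by linarith [hs.1]
  have hpi := Real.pi_pos
  have hsin : 0 < Real.sin (Real.pi * s) :=
    Real.sin_pos_of_pos_of_lt_pi (by positivity) (by nlinarith [hs.2])
  have hcos : Real.cos (Real.pi * s) < 0 :=
    Real.cos_neg_of_pi_div_two_lt_of_lt (by nlinarith [hs.1]) (by nlinarith [hs.2])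
  have g1 : 0 < Real.Gamma (1 - s) := Real.Gamma_pos_of_pos (by linarith [hs.2])
  have g2 : 0 < Real.Gamma s := Real.Gamma_pos_of_pos hs0
  have r1 := Real.Gamma_mul_Gamma_one_sub (1 / 2 + s)
  rw [show Real.pi * (1 / 2 + s) = Real.pi * s + Real.pi / 2 by ring, Real.sin_add_pi_div_two,
    show 1 - (1 / 2 + s) = 1 / 2 - s by ring] at r1
  have r2 := Real.Gamma_mul_Gamma_one_sub s
  have r3 : |Real.Gamma (-s)| = Real.Gamma (1 - s) / s := by
    have := Real.Gamma_add_one (neg_ne_zero.2 hs0.ne')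
    rw [show -s + 1 = 1 - s by ring] at this
    have h : Real.Gamma (-s) = -(Real.Gamma (1 - s) / s) := by
      rw [this]; field_simp
    rw [h, abs_neg, abs_of_pos (by positivity)]
  have r4 : Real.pi ^ (-(1 / 2) : ℝ) = (Real.sqrt Real.pi)⁻¹ := by
    rw [Real.sqrt_eq_rpow, Real.rpow_neg hpi.le]
  have r5 : (2 : ℝ) ^ (-2 * (s - 1 / 2) - 1) = ((4 : ℝ) ^ s)⁻¹ := by
    rw [show (4 : ℝ) = 2 ^ (2 : ℝ) by norm_num, ← Real.rpow_mul (by norm_num),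
      ← Real.rpow_neg (by norm_num)]
    congr 1; ring
  rw [greenConst, fracLapConst, r3, r4, r5, show 2 * s / 2 = s by ring,
    show -(s - 1 / 2) = 1 / 2 - s by ring, show s - 1 / 2 + 1 / 2 = s by ring]
  have h4 : 0 < (4 : ℝ) ^ s := by positivity
  have hsq : Real.sqrt Real.pi * Real.sqrt Real.pi = Real.pi := Real.mul_self_sqrt hpi.le
  have hsq0 : 0 < Real.sqrt Real.pi := Real.sqrt_pos.2 hpi
  -- The identity in independent symbols: a = 4^s, b = Γ(1/2-s), c = Γ(1/2+s), g = Γ(1-s), k = Γ(s),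
  -- t = √π, S and C the sine and cosine of πs.
  have e : ∀ a b c g k t S C : ℝ, a ≠ 0 → t ≠ 0 → g ≠ 0 → k ≠ 0 → S ≠ 0 → C ≠ 0 →
      t * t = Real.pi → c * b = Real.pi / C → k * g = Real.pi / S →
      -(-(t⁻¹ * a⁻¹ * (b / k))) * (a / t * (c / (g / s))) *
        (2 / (2 * s) * (Real.pi * (C / S))) = 1 := by
    intro a b c g k t S C ha ht hg hk hS hC h1 h2 h3
    have : -(-(t⁻¹ * a⁻¹ * (b / k))) * (a / t * (c / (g / s))) *
        (2 / (2 * s) * (Real.pi * (C / S))) =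
        (c * b) * C * Real.pi / ((t * t) * (k * g) * S) := by
      field_simp
    rw [this, h1, h2, h3]
    field_simp
  exact e _ _ _ _ _ _ _ _ h4.ne' hsq0.ne' g1.ne' g2.ne' hsin.ne' hcos.ne hsq r1 r2

/-! ### The Green potential solves the equation -/

/-- Subadditivity of t ↦ t^q for q ≤ 1. Uniformity in y lets the kernel be integrated against any ρ
in L¹, without moment conditions. -/
theorem abs_abs_sub_rpow_sub_le {q : ℝ} (hq : 0 ≤ q) (hq1 : q ≤ 1) (x y : ℝ) :
    |(|x - y| ^ q - |y| ^ q)| ≤ |x| ^ q := by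
  have h : ∀ a b c : ℝ, |a| ≤ |b| + |c| → |a| ^ q ≤ |b| ^ q + |c| ^ q := fun a b c h =>
    (Real.rpow_le_rpow (abs_nonneg _) h hq).trans
      (Real.rpow_add_le_add_rpow (abs_nonneg b) (abs_nonneg c) hq hq1)
  have h1 := h (x - y) x y (abs_sub x y)
  have h2 := h y x (x - y) (by
    have := abs_sub x (x - y)
    rwa [sub_sub_cancel] at this)
  rw [abs_le]; constructor <;> linarith

theorem integrable_riesz_kernel_mul {q : ℝ} (hq : 0 < q) (hq1 : q ≤ 1) {ρ : ℝ → ℝ}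
    (hρ : Integrable ρ) {g : ℝ → ℝ} (hg : Continuous g) (hgi : Integrable fun x => |x| ^ q * g x) :
    Integrable (fun z : ℝ × ℝ => (|z.1 - z.2| ^ q - |z.2| ^ q) * ρ z.2 * g z.1)
      ((volume : Measure ℝ).prod volume) := by
  have hk : Continuous fun z : ℝ × ℝ => |z.1 - z.2| ^ q - |z.2| ^ q :=
    ((continuous_abs_rpow hq).comp (by fun_prop)).sub ((continuous_abs_rpow hq).comp (by fun_prop))
  refine (hgi.norm.mul_prod hρ.norm).mono' ?_ (Eventually.of_forall fun z => ?_)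
  · exact (hk.aestronglyMeasurable.mul hρ.1.comp_snd).mul
      (hg.comp continuous_fst).aestronglyMeasurable
  · rw [norm_mul, norm_mul, norm_mul, Real.norm_eq_abs (_ - _),
      Real.norm_of_nonneg (by positivity : (0:ℝ) ≤ |z.1| ^ q)]
    calc _ ≤ |z.1| ^ q * ‖ρ z.2‖ * ‖g z.1‖ := by
          gcongr; exact abs_abs_sub_rpow_sub_le hq.le hq1 _ _
      _ = _ := by ring

theorem aestronglyMeasurable_greenPotential {s : ℝ} (hs : s ∈ Ioo (1 / 2 : ℝ) 1) {ρ : ℝ → ℝ}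
    (hρ : Integrable ρ) : AEStronglyMeasurable (greenPotential s ρ) := by
  have hq : 0 < 2 * (s - 1 / 2) := by linarith [hs.1]
  have hk : Continuous fun z : ℝ × ℝ =>
      |z.1 - z.2| ^ (2 * (s - 1 / 2)) - |z.2| ^ (2 * (s - 1 / 2)) :=
    ((continuous_abs_rpow hq).comp (by fun_prop)).sub ((continuous_abs_rpow hq).comp (by fun_prop))
  have : AEStronglyMeasurable (fun z : ℝ × ℝ =>
      (|z.1 - z.2| ^ (2 * (s - 1 / 2)) - |z.2| ^ (2 * (s - 1 / 2))) * ρ z.2)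
      ((volume : Measure ℝ).prod volume) := hk.aestronglyMeasurable.mul hρ.1.comp_snd
  exact this.integral_prod_right'.const_mul _

theorem abs_greenPotential_le {s : ℝ} (hs : s ∈ Ioo (1 / 2 : ℝ) 1) {ρ : ℝ → ℝ}
    (hρ : Integrable ρ) (x : ℝ) :
    |greenPotential s ρ x| ≤ |greenConst (s - 1 / 2)| * (∫ y, ‖ρ y‖) * |x| ^ (2 * s - 1) := by
  rw [greenPotential, abs_mul, abs_neg, mul_assoc]
  gcongr
  have := norm_integral_le_of_norm_le (hρ.norm.const_mul (|x| ^ (2 * s - 1)))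
    (f := fun y => (|x - y| ^ (2 * (s - 1 / 2)) - |y| ^ (2 * (s - 1 / 2))) * ρ y)
    (Eventually.of_forall fun y => by
      rw [norm_mul, show 2 * (s - 1 / 2) = 2 * s - 1 by ring]
      gcongr
      exact abs_abs_sub_rpow_sub_le (by linarith [hs.1]) (by linarith [hs.2]) x y)
  rw [integral_const_mul, mul_comm (|x| ^ (2 * s - 1))] at this
  exact this

theorem integrable_abs_rpow_mul_singLap {p : ℝ} (hp : 1 < p) (hp2 : p < 2) {φ : ℝ → ℝ}
    (hφ : ContDiff ℝ 2 φ) (hc : HasCompactSupport φ) :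
    Integrable fun x => |x| ^ (p - 1) * singLap p φ x := by
  obtain ⟨C, hC0, hC⟩ := exists_abs_singLap_le hp hp2 hφ hc
  refine ((integrable_one_add_abs_rpow_mul_rpow p).const_mul C).mono'
    ((continuous_abs_rpow (by linarith)).mul
      (continuous_singLap_of_hasCompactSupport hp hp2 hφ hc)).aestronglyMeasurable
    (Eventually.of_forall fun x => ?_)
  rw [norm_mul, Real.norm_of_nonneg (by positivity), Real.norm_eq_abs]
  calc |x| ^ (p - 1) * |singLap p φ x|
      ≤ (1 + |x|) ^ (p - 1) * (C * (1 + |x|) ^ (-1 - p)) := by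
        have h1 : |x| ^ (p - 1) ≤ (1 + |x|) ^ (p - 1) :=
          Real.rpow_le_rpow (abs_nonneg x) (by linarith) (by linarith)
        exact mul_le_mul h1 (hC x) (abs_nonneg _) (by positivity)
    _ = _ := by ring

theorem integrable_singLap {p : ℝ} (hp : 1 < p) (hp2 : p < 2) {φ : ℝ → ℝ}
    (hφ : ContDiff ℝ 2 φ) (hc : HasCompactSupport φ) : Integrable (singLap p φ) := by
  obtain ⟨C, hC0, hC⟩ := exists_abs_singLap_le hp hp2 hφ hc
  refine ((integrable_one_add_abs_rpow_mul_rpow p).const_mul C).mono'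
    (continuous_singLap_of_hasCompactSupport hp hp2 hφ hc).aestronglyMeasurable
    (Eventually.of_forall fun x => (hC x).trans ?_)
  gcongr
  refine le_mul_of_one_le_left (by positivity) ?_
  exact Real.one_le_rpow (by linarith [abs_nonneg x]) (by linarith)

theorem integral_riesz_kernel_mul_singLap {p : ℝ} (hp : 1 < p) (hp2 : p < 2) {φ : ℝ → ℝ}
    (hφ : ContDiff ℝ 2 φ) (hc : HasCompactSupport φ) (y : ℝ) :
    ∫ x, (|x - y| ^ (p - 1) - |y| ^ (p - 1)) * singLap p φ x =
      2 / p * (Real.pi * (Real.cos (Real.pi * (p / 2)) / Real.sin (Real.pi * (p / 2)))) * φ y := by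
  have hi := integrable_singLap hp hp2 hφ hc
  have h2 : Integrable fun x => |y| ^ (p - 1) * singLap p φ x := hi.const_mul _
  have h1 : Integrable fun x => |x - y| ^ (p - 1) * singLap p φ x := by
    have h3 : Integrable fun x => |x| ^ (p - 1) * singLap p φ x + |y| ^ (p - 1) * singLap p φ x :=
      (integrable_abs_rpow_mul_singLap hp hp2 hφ hc).add h2
    refine h3.norm.mono' (((continuous_abs_rpow (by linarith)).comp (by fun_prop)).mul
      (continuous_singLap_of_hasCompactSupport hp hp2 hφ hc)).aestronglyMeasurable
      (Eventually.of_forall fun x => ?_)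
    rw [← add_mul, norm_mul, norm_mul]
    gcongr
    rw [Real.norm_of_nonneg (by positivity),
      Real.norm_of_nonneg (by positivity)]
    have := (abs_le.1 (abs_abs_sub_rpow_sub_le (q := p - 1) (by linarith) (by linarith) x y)).2
    linarith
  simp_rw [sub_mul]
  rw [integral_sub h1 h2, integral_const_mul, integral_singLap hp hp2 hφ hc, mul_zero, sub_zero,
    integral_abs_sub_rpow_mul_singLap hp hp2 hφ hc]

theorem solvesFracLap_greenPotential {s : ℝ} (hs : s ∈ Ioo (1 / 2 : ℝ) 1) {ρ : ℝ → ℝ}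
    (hρ : Integrable ρ) : SolvesFracLap s (greenPotential s ρ) ρ := by
  intro φ hφ hc
  have hp : 1 < 2 * s := by linarith [hs.1]
  have hp2 : 2 * s < 2 := by linarith [hs.2]
  have hφ2 : ContDiff ℝ 2 φ := hφ.of_le (WithTop.coe_le_coe.2 le_top)
  have hint := integrable_riesz_kernel_mul (q := 2 * s - 1) (by linarith) (by linarith) hρ
    (continuous_singLap_of_hasCompactSupport hp hp2 hφ2 hc)
    (integrable_abs_rpow_mul_singLap hp hp2 hφ2 hc)
  set κ := 2 / (2 * s) * (Real.pi * (Real.cos (Real.pi * (2 * s / 2)) /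
    Real.sin (Real.pi * (2 * s / 2)))) with hκ
  calc ∫ x, greenPotential s ρ x * fracLap s φ x
      = ∫ x, -greenConst (s - 1 / 2) * fracLapConst s *
          ∫ y, (|x - y| ^ (2 * s - 1) - |y| ^ (2 * s - 1)) * ρ y * singLap (2 * s) φ x := by
        congr 1; ext x
        rw [fracLap_eq hs hφ2 hc, greenPotential, integral_mul_const,
          show 2 * (s - 1 / 2) = 2 * s - 1 by ring]
        ring
    _ = -greenConst (s - 1 / 2) * fracLapConst s *
          ∫ y, ∫ x, (|x - y| ^ (2 * s - 1) - |y| ^ (2 * s - 1)) * ρ y * singLap (2 * s) φ x := by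
        rw [integral_const_mul, integral_integral_swap (f := fun x y =>
          (|x - y| ^ (2 * s - 1) - |y| ^ (2 * s - 1)) * ρ y * singLap (2 * s) φ x) hint]
    _ = -greenConst (s - 1 / 2) * fracLapConst s * ∫ y, κ * (ρ y * φ y) := by
        congr 2; ext y
        have := integral_riesz_kernel_mul_singLap hp hp2 hφ2 hc y
        rw [← hκ] at this
        calc _ = ∫ x, ρ y *
              ((|x - y| ^ (2 * s - 1) - |y| ^ (2 * s - 1)) * singLap (2 * s) φ x) := by
              congr 1; ext x; ring
          _ = _ := by rw [integral_const_mul, this]; ring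
    _ = _ := by
        rw [integral_const_mul, ← mul_assoc, neg_greenConst_mul_fracLapConst hs, one_mul]

/-! ### From test functions to decaying functions -/

/-- Cutting off preserves the decay of a function and of its derivatives, uniformly. -/
theorem exists_cutoff {f : ℝ → ℝ} (hf : ContDiff ℝ ∞ f) {C : ℝ}
    (h0 : ∀ x, |f x| ≤ C * (1 + |x|)⁻¹) (hi : Integrable f)
    (h1 : ∀ x, |deriv f x| ≤ C * ((1 + |x|) ^ 2)⁻¹)
    (h2 : ∀ x, |deriv (deriv f) x| ≤ C * ((1 + |x|) ^ 3)⁻¹) :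
    ∃ (F : ℕ → ℝ → ℝ) (A : ℝ), (∀ n, ContDiff ℝ ∞ (F n)) ∧ (∀ n, HasCompactSupport (F n)) ∧
      (∀ x, Tendsto (fun n => F n x) atTop (𝓝 (f x))) ∧
      (∀ n x, |F n x| ≤ A * (1 + |x|)⁻¹) ∧ (∀ n, ∫ x, |F n x| ≤ A) ∧
      ∀ n x, |deriv (deriv (F n)) x| ≤ A * ((1 + |x|) ^ 3)⁻¹ := by
  let χ : ContDiffBump (0 : ℝ) := ⟨1, 2, one_pos, one_lt_two⟩
  have hχ : ContDiff ℝ ∞ χ := χ.contDiff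
  have hχc : HasCompactSupport χ := χ.hasCompactSupport
  have hχ1 : ContDiff ℝ ∞ (deriv χ) := (contDiff_infty_iff_deriv.1 hχ).2
  have hχ2 : ContDiff ℝ ∞ (deriv (deriv χ)) := (contDiff_infty_iff_deriv.1 hχ1).2
  have hf1 : ContDiff ℝ ∞ (deriv f) := (contDiff_infty_iff_deriv.1 hf).2
  have c1 : Continuous fun y => deriv χ y * (1 + |y|) := hχ1.continuous.mul (by fun_prop)
  have c2 : Continuous fun y => deriv (deriv χ) y * (1 + |y|) ^ 2 :=
    hχ2.continuous.mul (by fun_prop)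
  have s1 : HasCompactSupport fun y => deriv χ y * (1 + |y|) := hχc.deriv.mul_right
  have s2 : HasCompactSupport fun y => deriv (deriv χ) y * (1 + |y|) ^ 2 :=
    hχc.deriv.deriv.mul_right
  obtain ⟨B1, hB1⟩ := exists_bound_of_hasCompactSupport c1 s1
  obtain ⟨B2, hB2⟩ := exists_bound_of_hasCompactSupport c2 s2
  have hC : 0 ≤ C := by simpa using (abs_nonneg _).trans (h0 0)
  have hB1' : 0 ≤ B1 := (abs_nonneg _).trans (hB1 0)
  have hB2' : 0 ≤ B2 := (abs_nonneg _).trans (hB2 0)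
  have hI : 0 ≤ ∫ x, |f x| := integral_nonneg fun x => abs_nonneg (f x)
  have hχle : ∀ y, |χ y| ≤ 1 := fun y => by
    rw [abs_of_nonneg χ.nonneg]; exact χ.le_one
  have hr0 : ∀ n : ℕ, 0 < ((n : ℝ) + 1)⁻¹ := fun n => by positivity
  have hr1 : ∀ n : ℕ, ((n : ℝ) + 1)⁻¹ ≤ 1 := fun n =>
    inv_le_one_of_one_le₀ (by linarith [n.cast_nonneg (α := ℝ)])
  -- Each derivative falling on the cutoff brings a factor r ≤ 1; this inequality converts it into a
  -- factor (1+|x|)^(-1) uniformly in r.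
  have hscale : ∀ r x : ℝ, 0 < r → r ≤ 1 → (1 + |x|) * r ≤ 1 + |r * x| := by
    intro r x hr hr1
    rw [abs_mul, abs_of_pos hr]
    linarith
  have e1 : ∀ r x : ℝ, 0 < r → r ≤ 1 → |deriv χ (r * x) * r| ≤ B1 * (1 + |x|)⁻¹ := by
    intro r x hr hr1
    rw [← div_eq_mul_inv, le_div_iff₀ (by positivity), abs_mul, abs_of_pos hr]
    have := hB1 (r * x)
    rw [abs_mul, abs_of_nonneg (by positivity : 0 ≤ 1 + |r * x|)] at this
    calc _ = |deriv χ (r * x)| * ((1 + |x|) * r) := by ring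
      _ ≤ |deriv χ (r * x)| * (1 + |r * x|) :=
        mul_le_mul_of_nonneg_left (hscale r x hr hr1) (abs_nonneg _)
      _ ≤ _ := this
  have e2 : ∀ r x : ℝ, 0 < r → r ≤ 1 →
      |deriv (deriv χ) (r * x) * r ^ 2| ≤ B2 * ((1 + |x|) ^ 2)⁻¹ := by
    intro r x hr hr1
    rw [← div_eq_mul_inv, le_div_iff₀ (by positivity), abs_mul, abs_of_pos (pow_pos hr 2)]
    have := hB2 (r * x)
    rw [abs_mul, abs_of_nonneg (by positivity : 0 ≤ (1 + |r * x|) ^ 2)] at this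
    calc _ = |deriv (deriv χ) (r * x)| * ((1 + |x|) * r) ^ 2 := by ring
      _ ≤ |deriv (deriv χ) (r * x)| * (1 + |r * x|) ^ 2 :=
        mul_le_mul_of_nonneg_left (pow_le_pow_left₀ (by positivity) (hscale r x hr hr1) 2)
          (abs_nonneg _)
      _ ≤ _ := this
  have d0 : ∀ {g : ℝ → ℝ}, ContDiff ℝ ∞ g → ∀ x, HasDerivAt g (deriv g x) x := fun hg x =>
    (hg.differentiable (by simp) x).hasDerivAt
  have dχ : ∀ {g : ℝ → ℝ}, ContDiff ℝ ∞ g → ∀ (r x : ℝ),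
      HasDerivAt (fun x => g (r * x)) (deriv g (r * x) * r) x := fun hg r x => by
    exact ((d0 hg (r * x)).comp x ((hasDerivAt_id' x).const_mul r)).congr_deriv (by ring)
  have hd1 : ∀ n : ℕ, deriv (fun x => f x * χ (((n : ℝ) + 1)⁻¹ * x)) = fun x =>
      deriv f x * χ (((n : ℝ) + 1)⁻¹ * x) +
        f x * (deriv χ (((n : ℝ) + 1)⁻¹ * x) * ((n : ℝ) + 1)⁻¹) := fun n => by
    ext x; exact ((d0 hf x).mul (dχ hχ _ x)).deriv
  have hd2 : ∀ (n : ℕ) (x : ℝ), deriv (deriv (fun x => f x * χ (((n : ℝ) + 1)⁻¹ * x))) x =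
      deriv (deriv f) x * χ (((n : ℝ) + 1)⁻¹ * x) +
        2 * deriv f x * (deriv χ (((n : ℝ) + 1)⁻¹ * x) * ((n : ℝ) + 1)⁻¹) +
        f x * (deriv (deriv χ) (((n : ℝ) + 1)⁻¹ * x) * (((n : ℝ) + 1)⁻¹) ^ 2) := fun n x => by
    rw [hd1]
    refine (((d0 hf1 x).mul (dχ hχ _ x)).add
      ((d0 hf x).mul ((dχ hχ1 _ x).mul_const _))).deriv.trans ?_
    ring
  have hle : ∀ (n : ℕ) (x : ℝ), |f x * χ (((n : ℝ) + 1)⁻¹ * x)| ≤ |f x| := fun n x => by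
    rw [abs_mul]; exact mul_le_of_le_one_right (abs_nonneg _) (hχle _)
  have hF : ∀ n : ℕ, ContDiff ℝ ∞ fun x => f x * χ (((n : ℝ) + 1)⁻¹ * x) := fun n =>
    hf.mul (hχ.comp (contDiff_const.mul contDiff_id))
  -- The constant adds the three Leibniz terms of the second derivative and the L¹ norm of f, so
  -- that one A serves all bounds.
  refine ⟨fun n x => f x * χ (((n : ℝ) + 1)⁻¹ * x),
    (C + 2 * C * B1 + C * B2) + ∫ x, |f x|, hF, fun n => ?_, fun x => ?_, fun n x => ?_,
    fun n => ?_, fun n x => ?_⟩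
  · exact (hχc.comp_homeomorph (Homeomorph.mulLeft₀ (((n : ℝ) + 1)⁻¹)
      (by positivity))).mul_left
  · have t1 : Tendsto (fun n : ℕ => ((n : ℝ) + 1)⁻¹ * x) atTop (𝓝 0) := by
      have := (tendsto_one_div_add_atTop_nhds_zero_nat (𝕜 := ℝ)).mul_const x
      simpa using this
    have t2 := (hχ.continuous.tendsto 0).comp t1
    have : χ 0 = 1 := χ.one_of_mem_closedBall (by simp; exact zero_le_one)
    rw [this] at t2
    simpa using t2.const_mul (f x)
  · refine ((hle n x).trans (h0 x)).trans ?_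
    gcongr
    have : 0 ≤ C * B1 := by positivity
    have : 0 ≤ C * B2 := by positivity
    linarith
  · have : ∫ x, |f x * χ (((n : ℝ) + 1)⁻¹ * x)| ≤ ∫ x, |f x| := by
      refine integral_mono_of_nonneg (Eventually.of_forall fun x => abs_nonneg _) hi.norm
        (Eventually.of_forall fun x => hle n x)
    refine this.trans (le_add_of_nonneg_left (by positivity))
  · simp only [hd2]
    have b0 : |deriv (deriv f) x * χ (((n : ℝ) + 1)⁻¹ * x)| ≤ C * ((1 + |x|) ^ 3)⁻¹ := by
      rw [abs_mul]; exact (mul_le_of_le_one_right (abs_nonneg _) (hχle _)).trans (h2 x)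
    have b1 : |2 * deriv f x * (deriv χ (((n : ℝ) + 1)⁻¹ * x) * ((n : ℝ) + 1)⁻¹)| ≤
        2 * C * B1 * ((1 + |x|) ^ 3)⁻¹ := by
      rw [abs_mul, abs_mul, abs_two]
      calc _ ≤ 2 * (C * ((1 + |x|) ^ 2)⁻¹) * (B1 * (1 + |x|)⁻¹) := by
            gcongr
            · exact h1 x
            · exact e1 _ x (hr0 n) (hr1 n)
        _ = _ := by rw [pow_succ (1 + |x|) 2, mul_inv]; ring
    have b2 : |f x * (deriv (deriv χ) (((n : ℝ) + 1)⁻¹ * x) * (((n : ℝ) + 1)⁻¹) ^ 2)| ≤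
        C * B2 * ((1 + |x|) ^ 3)⁻¹ := by
      rw [abs_mul]
      calc _ ≤ (C * (1 + |x|)⁻¹) * (B2 * ((1 + |x|) ^ 2)⁻¹) := by
            gcongr
            · exact h0 x
            · exact e2 _ x (hr0 n) (hr1 n)
        _ = _ := by rw [pow_succ (1 + |x|) 2, mul_inv]; ring
    refine (abs_add_three _ _ _).trans ?_
    calc _ ≤ C * ((1 + |x|) ^ 3)⁻¹ + 2 * C * B1 * ((1 + |x|) ^ 3)⁻¹ +
          C * B2 * ((1 + |x|) ^ 3)⁻¹ := by gcongr
      _ = (C + 2 * C * B1 + C * B2) * ((1 + |x|) ^ 3)⁻¹ := by ring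
      _ ≤ _ := mul_le_mul_of_nonneg_right (le_add_of_nonneg_right hI) (by positivity)

/-- A weak solution of the homogeneous equation also annihilates `singLap p f` for decaying,
not necessarily compactly supported, smooth functions `f`. -/
theorem integral_mul_singLap_eq_zero_of_decay {p : ℝ} (hp : 1 < p) (hp2 : p < 2) {w : ℝ → ℝ}
    (hwm : AEStronglyMeasurable w) (hw : Integrable fun x => |w x| * (1 + |x|) ^ (-1 - p))
    (h : ∀ φ : ℝ → ℝ, ContDiff ℝ ∞ φ → HasCompactSupport φ → ∫ x, w x * singLap p φ x = 0)
    {f : ℝ → ℝ} (hf : ContDiff ℝ ∞ f) {C : ℝ}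
    (h0 : ∀ x, |f x| ≤ C * (1 + |x|)⁻¹) (hi : Integrable f)
    (h1 : ∀ x, |deriv f x| ≤ C * ((1 + |x|) ^ 2)⁻¹)
    (h2 : ∀ x, |deriv (deriv f) x| ≤ C * ((1 + |x|) ^ 3)⁻¹) :
    ∫ x, w x * singLap p f x = 0 := by
  obtain ⟨F, A, hF, hFc, hlim, g0, g1, g2⟩ := exists_cutoff hf h0 hi h1 h2
  have hF2 : ∀ n, ContDiff ℝ 2 (F n) := fun n => (hF n).of_le (WithTop.coe_le_coe.2 le_top)
  have hA : 0 ≤ A := (integral_nonneg fun x => abs_nonneg (F 0 x)).trans (g1 0)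
  have hle : ∀ x : ℝ, (1 + |x|)⁻¹ ≤ 1 := fun x =>
    inv_le_one_of_one_le₀ (by linarith [abs_nonneg x])
  have hle3 : ∀ x : ℝ, ((1 + |x|) ^ 3)⁻¹ ≤ 1 := fun x =>
    inv_le_one_of_one_le₀ (one_le_pow₀ (by linarith [abs_nonneg x]))
  have hT : Tendsto (fun n => ∫ x, w x * singLap p (F n) x) atTop
      (𝓝 (∫ x, w x * singLap p f x)) := by
    refine tendsto_integral_of_dominated_convergence
      (fun x => singLapDecayConst p * A * (|w x| * (1 + |x|) ^ (-1 - p))) (fun n => ?_)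
      (hw.const_mul _) (fun n => Eventually.of_forall fun x => ?_)
      (Eventually.of_forall fun x => ?_)
    · exact hwm.mul
        (continuous_singLap_of_hasCompactSupport hp hp2 (hF2 n) (hFc n)).aestronglyMeasurable
    · rw [norm_mul, Real.norm_eq_abs, Real.norm_eq_abs]
      calc _ ≤ |w x| * (singLapDecayConst p * A * (1 + |x|) ^ (-1 - p)) := by
            gcongr
            exact abs_singLap_le hp hp2 (hF2 n) (g0 n)
              ((hF n).continuous.integrable_of_hasCompactSupport (hFc n)) (g1 n) (g2 n) x
        _ = _ := by ring
    · refine Tendsto.const_mul _ (tendsto_singLap hp hp2 (N := A) (M := A)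
        (Eventually.of_forall fun n => ⟨hF2 n,
          fun x => (g0 n x).trans (mul_le_of_le_one_right hA (hle x)),
          fun x => (g2 n x).trans (mul_le_of_le_one_right hA (hle3 x))⟩) fun t => ?_)
      exact (((hlim x).const_mul 2).sub (hlim (x + t))).sub (hlim (x - t))
  refine tendsto_nhds_unique hT ?_
  simp only [h _ (hF _) (hFc _)]
  exact tendsto_const_nhds

/-! ### Riesz convolutions and their decay -/

/-- Convolution with the Riesz kernel `|z| ^ (p - 1)`. -/
noncomputable def rieszConv (p : ℝ) (ψ : ℝ → ℝ) (x : ℝ) : ℝ := ∫ z, |z| ^ (p - 1) * ψ (x - z)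

theorem rieszConv_eq_convolution (p : ℝ) (ψ : ℝ → ℝ) :
    rieszConv p ψ =
      convolution (fun z => |z| ^ (p - 1)) ψ (ContinuousLinearMap.mul ℝ ℝ) volume := rfl

theorem contDiff_rieszConv {p : ℝ} (hp : 1 < p) {ψ : ℝ → ℝ} (hψ : ContDiff ℝ ∞ ψ)
    (hc : HasCompactSupport ψ) : ContDiff ℝ ∞ (rieszConv p ψ) :=
  rieszConv_eq_convolution p ψ ▸ hc.contDiff_convolution_right (ContinuousLinearMap.mul ℝ ℝ) (continuous_abs_rpow (by linarith)).locallyIntegrable hψ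

theorem deriv_rieszConv {p : ℝ} (hp : 1 < p) {ψ : ℝ → ℝ} (hψ : ContDiff ℝ ∞ ψ)
    (hc : HasCompactSupport ψ) : deriv (rieszConv p ψ) = rieszConv p (deriv ψ) := by
  ext x
  exact (hc.hasDerivAt_convolution_right (ContinuousLinearMap.mul ℝ ℝ)
    (continuous_abs_rpow (by linarith)).locallyIntegrable
    (hψ.of_le (WithTop.coe_le_coe.2 le_top)) x).deriv

theorem secondDiff_rieszConv {p : ℝ} (hp : 1 < p) {ψ : ℝ → ℝ} (hψ : Continuous ψ)
    (hc : HasCompactSupport ψ) (x h : ℝ) :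
    secondDiff (rieszConv p ψ) x h =
      ∫ z, |z| ^ (p - 1) * secondDiff (fun z => ψ (x - z)) z h := by
  have i : ∀ y, Integrable fun z => |z| ^ (p - 1) * ψ (y - z) := fun y =>
    ((continuous_abs_rpow (by linarith)).mul (hψ.comp (by fun_prop))).integrable_of_hasCompactSupport
      (hc.comp_homeomorph (Homeomorph.subLeft y)).mul_left
  unfold secondDiff rieszConv
  rw [sub_right_comm, ← integral_two_mul_sub_sub (i x) (i (x - h)) (i (x + h))]
  congr 1; ext z
  beta_reduce
  rw [show x - (z + h) = x - h - z by ring, show x - (z - h) = x + h - z by ring]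
  ring

theorem singLap_rieszConv {p : ℝ} (hp : 1 < p) (hp2 : p < 2) {ψ : ℝ → ℝ} (hψ : ContDiff ℝ 1 ψ)
    (hc : HasCompactSupport ψ) (x : ℝ) :
    singLap p (rieszConv p ψ) x =
      2 / p * (Real.pi * (Real.cos (Real.pi * (p / 2)) / Real.sin (Real.pi * (p / 2)))) * ψ x := by
  have := integral_rpow_mul_integral_abs_rpow_mul_secondDiff hp hp2
    (φ := fun z => ψ (x - z)) (hψ.comp (by fun_prop))
    (hc.comp_homeomorph (Homeomorph.subLeft x))
  rw [sub_zero] at this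
  rw [← this, singLap]
  simp only [secondDiff_rieszConv hp hψ.continuous hc]

theorem integrable_mul_of_continuousOn_tsupport {g ψ : ℝ → ℝ} (hψ : Continuous ψ)
    (hc : HasCompactSupport ψ) (hg : ContinuousOn g (tsupport ψ)) :
    Integrable fun z => g z * ψ z := by
  have : IntegrableOn (fun z => g z * ψ z) (tsupport ψ) :=
    (hg.mul hψ.continuousOn).integrableOn_compact hc
  exact this.integrable_of_forall_notMem_eq_zero fun x hx => by
    rw [image_eq_zero_of_notMem_tsupport hx, mul_zero]

/-- For x away from the support the kernel is smooth there and x - z keeps the sign of x, so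
integrating by parts lowers the exponent by one. Iterated, each derivative of ψ yields one more
power of decay. -/
theorem abs_integral_abs_sub_rpow_mul_deriv {ψ : ℝ → ℝ} (hψ : ContDiff ℝ 1 ψ)
    (hc : HasCompactSupport ψ) {a x : ℝ} (ha : tsupport ψ ⊆ Icc (-a) a) (hx : a < |x|) (β : ℝ) :
    |∫ z, |x - z| ^ β * deriv ψ z| = |β| * |∫ z, |x - z| ^ (β - 1) * ψ z| := by
  have hne : ∀ z ∈ tsupport ψ, x - z ≠ 0 := fun z hz h => by
    have h1 : |z| ≤ a := abs_le.2 (ha hz)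
    rw [sub_eq_zero.1 h] at hx
    linarith
  have hsign : ∀ z ∈ tsupport ψ, Real.sign (x - z) = Real.sign x := fun z hz => by
    have h1 := ha hz
    rcases lt_abs.1 hx with h | h
    · rw [Real.sign_of_pos (by linarith [h1.2]), Real.sign_of_pos (by linarith [h1.1, h1.2])]
    · rw [Real.sign_of_neg (by linarith [h1.1]), Real.sign_of_neg (by linarith [h1.1, h1.2])]
  have hcont : ∀ γ : ℝ, ContinuousOn (fun z => |x - z| ^ γ) (tsupport ψ) := fun γ =>
    ContinuousOn.rpow_const (by fun_prop) fun z hz => Or.inl (abs_ne_zero.2 (hne z hz))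
  have hd : ∀ z ∈ tsupport ψ, HasDerivAt (fun z => |x - z| ^ β)
      (-(β * (Real.sign x * |x - z| ^ (β - 1)))) z := fun z hz => by
    refine ((hasDerivAt_abs_rpow_of_ne_zero β (hne z hz)).comp z
      ((hasDerivAt_id' z).const_sub x)).congr_deriv ?_
    rw [hsign z hz]; ring
  have hcd := hψ.continuous_deriv le_rfl
  have key := integral_mul_deriv_eq_deriv_mul_of_integrable (u := fun z => |x - z| ^ β) (v := ψ)
    (u' := fun z => -(β * (Real.sign x * |x - z| ^ (β - 1)))) (v' := deriv ψ)
    hd (fun z _ => (hψ.differentiable one_ne_zero z).hasDerivAt)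
    (integrable_mul_of_continuousOn_tsupport hcd hc.deriv
      ((hcont β).mono (tsupport_deriv_subset)))
    (integrable_mul_of_continuousOn_tsupport hψ.continuous hc
      (((hcont (β - 1)).const_mul _).const_mul _).neg)
    (integrable_mul_of_continuousOn_tsupport hψ.continuous hc (hcont β))
  rw [key, ← integral_neg]
  have e : ∀ z, -(-(β * (Real.sign x * |x - z| ^ (β - 1))) * ψ z) =
      β * Real.sign x * (|x - z| ^ (β - 1) * ψ z) := fun z => by ring
  simp_rw [e]
  rw [integral_const_mul, abs_mul, abs_mul]
  -- The value x = 0 is possible only for negative a, when the support is empty.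
  have hs : |Real.sign x| = 1 ∨ tsupport ψ = ∅ := by
    by_contra! hcon
    obtain ⟨z, hz⟩ := hcon.2
    rw [← hsign z hz] at hcon
    rcases (hne z hz).lt_or_gt with h | h
    · simp [Real.sign_of_neg h] at hcon
    · simp [Real.sign_of_pos h] at hcon
  rcases hs with h | h
  · rw [h, mul_one]
  · rw [tsupport_eq_empty_iff] at h
    simp [h]

theorem ContDiff.iteratedDeriv_top {ψ : ℝ → ℝ} (hψ : ContDiff ℝ ∞ ψ) (m : ℕ) :
    ContDiff ℝ ∞ (iteratedDeriv m ψ) := by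
  induction m with
  | zero => simpa using hψ
  | succ m ih => rw [iteratedDeriv_succ]; exact (contDiff_infty_iff_deriv.1 ih).2

theorem tsupport_iteratedDeriv_subset_tsupport (ψ : ℝ → ℝ) (m : ℕ) :
    tsupport (iteratedDeriv m ψ) ⊆ tsupport ψ := by
  induction m with
  | zero => simp
  | succ m ih => rw [iteratedDeriv_succ]; exact tsupport_deriv_subset.trans ih

theorem HasCompactSupport.iteratedDeriv_real {ψ : ℝ → ℝ} (hc : HasCompactSupport ψ) (m : ℕ) :
    HasCompactSupport (iteratedDeriv m ψ) :=
  IsCompact.of_isClosed_subset hc (isClosed_tsupport _) (tsupport_iteratedDeriv_subset_tsupport ψ m)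

theorem exists_abs_integral_abs_sub_rpow_mul_iteratedDeriv {ψ : ℝ → ℝ} (hψ : ContDiff ℝ ∞ ψ)
    (hc : HasCompactSupport ψ) {a : ℝ} (ha : tsupport ψ ⊆ Icc (-a) a) (m : ℕ) (β : ℝ) :
    ∃ c, 0 ≤ c ∧ ∀ x, a < |x| → |∫ z, |x - z| ^ β * iteratedDeriv m ψ z| =
      c * |∫ z, |x - z| ^ (β - m) * ψ z| := by
  induction m generalizing β with
  | zero => exact ⟨1, zero_le_one, fun x _ => by simp⟩
  | succ m ih =>
    obtain ⟨c, hc0, hcx⟩ := ih (β - 1)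
    refine ⟨|β| * c, by positivity, fun x hx => ?_⟩
    have h1 := (hψ.iteratedDeriv_top m).of_le (n := ∞) (m := 1) (WithTop.coe_le_coe.2 le_top)
    rw [iteratedDeriv_succ, abs_integral_abs_sub_rpow_mul_deriv h1 (hc.iteratedDeriv_real m)
      ((tsupport_iteratedDeriv_subset_tsupport ψ m).trans ha) hx, hcx x hx]
    push_cast
    rw [show β - 1 - (m : ℝ) = β - (m + 1) by ring, mul_assoc]

theorem rieszConv_eq_integral_abs_sub (p : ℝ) (ψ : ℝ → ℝ) (x : ℝ) :
    rieszConv p ψ x = ∫ z, |x - z| ^ (p - 1) * ψ z := by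
  rw [rieszConv, ← integral_sub_left_eq_self _ volume x]
  simp

theorem exists_abs_rieszConv_iteratedDeriv_le {p : ℝ} (hp : 1 < p) (hp2 : p < 2) {ψ : ℝ → ℝ}
    (hψ : ContDiff ℝ ∞ ψ) (hc : HasCompactSupport ψ) {m : ℕ} (hm : 1 ≤ m) :
    ∃ C, 0 ≤ C ∧ ∀ x, |rieszConv p (iteratedDeriv m ψ) x| ≤ C * (1 + |x|) ^ (p - 1 - m) := by
  have hm' : (1 : ℝ) ≤ m := by exact_mod_cast hm
  obtain ⟨a, ha0, ha⟩ : ∃ a : ℝ, 0 ≤ a ∧ tsupport ψ ⊆ Icc (-a) a := by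
    obtain ⟨r, hr⟩ := hc.isBounded.subset_closedBall (0 : ℝ)
    refine ⟨max r 0, le_max_right _ _, hr.trans ?_⟩
    rw [Real.closedBall_eq_Icc, zero_sub, zero_add]
    exact Icc_subset_Icc (neg_le_neg (le_max_left _ _)) (le_max_left _ _)
  obtain ⟨c, hc0, hcx⟩ := exists_abs_integral_abs_sub_rpow_mul_iteratedDeriv hψ hc ha m (p - 1)
  have hcont := (contDiff_rieszConv hp (hψ.iteratedDeriv_top m) (hc.iteratedDeriv_real m)).continuous
  obtain ⟨N, hN⟩ := (isCompact_Icc (a := -(2 * a + 1)) (b := 2 * a + 1)).exists_bound_of_continuousOn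
    hcont.continuousOn
  have hN0 : 0 ≤ N := (norm_nonneg _).trans (hN 0 ⟨by linarith, by linarith⟩)
  have hI : 0 ≤ ∫ z, |ψ z| := integral_nonneg fun z => abs_nonneg _
  have hψi : Integrable ψ := hψ.continuous.integrable_of_hasCompactSupport hc
  set γ := p - 1 - (m : ℝ) with hγ
  have hγ0 : γ ≤ 0 := by linarith
  -- The first summand covers |x| ≤ 2a + 1 by compactness; beyond that radius |x - z| ≥ (1+|x|)/2 on
  -- the support, which gives the second.
  refine ⟨N / (2 * a + 2) ^ γ + c * (2⁻¹ ^ γ * ∫ z, |ψ z|), by positivity, fun x => ?_⟩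
  rw [add_mul]
  rcases le_or_gt |x| (2 * a + 1) with hx | hx
  · have h1 : N ≤ N / (2 * a + 2) ^ γ * (1 + |x|) ^ γ := by
      rw [div_mul_eq_mul_div, le_div_iff₀ (by positivity)]
      refine mul_le_mul_of_nonneg_left ?_ hN0
      exact Real.rpow_le_rpow_of_nonpos (by positivity) (by linarith) hγ0
    have h2 : 0 ≤ c * (2⁻¹ ^ γ * ∫ z, |ψ z|) * (1 + |x|) ^ γ := by positivity
    have h3 := hN x (abs_le.1 hx)
    rw [Real.norm_eq_abs] at h3
    linarith
  · have h0 : 0 ≤ N / (2 * a + 2) ^ γ * (1 + |x|) ^ γ := by positivity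
    rw [rieszConv_eq_integral_abs_sub, hcx x (by linarith)]
    have h1 : |∫ z, |x - z| ^ γ * ψ z| ≤ (2⁻¹ * (1 + |x|)) ^ γ * ∫ z, |ψ z| := by
      rw [← integral_const_mul]
      refine norm_integral_le_of_norm_le (f := fun z => |x - z| ^ γ * ψ z) (hψi.norm.const_mul _)
        (Eventually.of_forall fun z => ?_)
      rw [norm_mul, Real.norm_of_nonneg (by positivity)]
      by_cases hz : z ∈ tsupport ψ
      · refine mul_le_mul_of_nonneg_right ?_ (norm_nonneg _)
        refine Real.rpow_le_rpow_of_nonpos (by positivity) ?_ hγ0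
        have h2 : |z| ≤ a := abs_le.2 (ha hz)
        have h3 := abs_sub_abs_le_abs_sub x z
        linarith
      · rw [image_eq_zero_of_notMem_tsupport hz]; simp
    rw [Real.mul_rpow (by positivity) (by positivity)] at h1
    calc _ ≤ c * (2⁻¹ ^ γ * (1 + |x|) ^ γ * ∫ z, |ψ z|) := mul_le_mul_of_nonneg_left h1 hc0
      _ = c * (2⁻¹ ^ γ * ∫ z, |ψ z|) * (1 + |x|) ^ γ := by ring
      _ ≤ _ := le_add_of_nonneg_left h0

/-! ### Liouville's theorem and affine functions -/

/-- Liouville's theorem, in the form of a vanishing second derivative in the weak sense. -/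
theorem integral_mul_deriv_deriv_eq_zero {p : ℝ} (hp : 1 < p) (hp2 : p < 2) {w : ℝ → ℝ}
    (hwm : AEStronglyMeasurable w) (hw : Integrable fun x => |w x| * (1 + |x|) ^ (-1 - p))
    (h : ∀ φ : ℝ → ℝ, ContDiff ℝ ∞ φ → HasCompactSupport φ → ∫ x, w x * singLap p φ x = 0)
    {η : ℝ → ℝ} (hη : ContDiff ℝ ∞ η) (hc : HasCompactSupport η) :
    ∫ x, w x * deriv (deriv η) x = 0 := by
  -- The convolution with η'' is the first to be integrable: it decays like |x|^(p-3) with 3 - p >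
  -- 1. Its first two derivatives are the convolutions with the third and fourth derivatives of η.
  obtain ⟨C2, hC2, b2⟩ := exists_abs_rieszConv_iteratedDeriv_le hp hp2 hη hc (m := 2) (by norm_num)
  obtain ⟨C3, hC3, b3⟩ := exists_abs_rieszConv_iteratedDeriv_le hp hp2 hη hc (m := 3) (by norm_num)
  obtain ⟨C4, hC4, b4⟩ := exists_abs_rieszConv_iteratedDeriv_le hp hp2 hη hc (m := 4) (by norm_num)
  have hη2 := hη.iteratedDeriv_top 2
  have hc2 := hc.iteratedDeriv_real 2
  have e3 : deriv (rieszConv p (iteratedDeriv 2 η)) = rieszConv p (iteratedDeriv 3 η) := by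
    rw [deriv_rieszConv hp hη2 hc2, ← iteratedDeriv_succ]
  have e4 : deriv (rieszConv p (iteratedDeriv 3 η)) = rieszConv p (iteratedDeriv 4 η) := by
    rw [deriv_rieszConv hp (hη.iteratedDeriv_top 3) (hc.iteratedDeriv_real 3), ← iteratedDeriv_succ]
  have hdec : ∀ (C γ : ℝ) (k : ℕ), 0 ≤ C → C ≤ C2 + C3 + C4 → γ ≤ -(k : ℝ) → ∀ x : ℝ,
      C * (1 + |x|) ^ γ ≤ (C2 + C3 + C4) * ((1 + |x|) ^ k)⁻¹ := by
    intro C γ k hC hCle hγ x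
    rw [← Real.rpow_natCast, ← Real.rpow_neg (by positivity)]
    gcongr
    linarith [abs_nonneg x]
  have hcontR := (contDiff_rieszConv hp hη2 hc2)
  have key := integral_mul_singLap_eq_zero_of_decay hp hp2 hwm hw h hcontR (C := C2 + C3 + C4)
    (fun x => (b2 x).trans (by
      simpa using hdec C2 _ 1 hC2 (by linarith) (by push_cast; linarith) x))
    (by
      have i := (integrable_one_add_norm (E := ℝ) (μ := volume) (r := 3 - p)
        (by simp; linarith)).const_mul C2
      refine i.mono' hcontR.continuous.aestronglyMeasurable (Eventually.of_forall fun x => ?_)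
      refine (b2 x).trans (le_of_eq ?_)
      rw [Real.norm_eq_abs]; congr 2; push_cast; ring)
    (fun x => by
      rw [e3]
      exact (b3 x).trans (hdec C3 _ 2 hC3 (by linarith) (by push_cast; linarith) x))
    (fun x => by
      rw [e3, e4]
      exact (b4 x).trans (hdec C4 _ 3 hC4 (by linarith) (by push_cast; linarith) x))
  simp_rw [singLap_rieszConv hp hp2 (hη2.of_le (WithTop.coe_le_coe.2 le_top)) hc2,
    mul_left_comm (w _)] at key
  rw [integral_const_mul, iteratedDeriv_succ, iteratedDeriv_one] at key
  refine (mul_eq_zero.1 key).resolve_left ?_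
  have hs : 0 < Real.sin (Real.pi * (p / 2)) :=
    Real.sin_pos_of_pos_of_lt_pi (by positivity) (by nlinarith [Real.pi_pos])
  have hcos : Real.cos (Real.pi * (p / 2)) < 0 :=
    Real.cos_neg_of_pi_div_two_lt_of_lt (by nlinarith [Real.pi_pos]) (by nlinarith [Real.pi_pos])
  have hp0 : p ≠ 0 := by linarith
  exact mul_ne_zero (div_ne_zero two_ne_zero hp0)
    (mul_ne_zero Real.pi_ne_zero (div_ne_zero hcos.ne hs.ne'))

theorem exists_compactSupport_antideriv {ψ : ℝ → ℝ} (hψ : ContDiff ℝ ∞ ψ)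
    (hc : HasCompactSupport ψ) (h0 : ∫ x, ψ x = 0) :
    ∃ θ : ℝ → ℝ, ContDiff ℝ ∞ θ ∧ HasCompactSupport θ ∧ deriv θ = ψ := by
  obtain ⟨a, ha⟩ : ∃ a : ℝ, ∀ x, ψ x ≠ 0 → -a < x ∧ x < a := by
    obtain ⟨r, hr⟩ := hc.isBounded.subset_closedBall (0 : ℝ)
    refine ⟨r + 1, fun x hx => ?_⟩
    have := hr (subset_tsupport _ hx)
    rw [Real.closedBall_eq_Icc] at this
    exact ⟨by linarith [this.1], by linarith [this.2]⟩
  set θ : ℝ → ℝ := fun x => ∫ t in (-a)..x, ψ t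
  have hd : ∀ x, HasDerivAt θ (ψ x) x := fun x =>
    intervalIntegral.integral_hasDerivAt_right (hψ.continuous.intervalIntegrable _ _)
      (hψ.continuous.stronglyMeasurableAtFilter _ _) hψ.continuous.continuousAt
  have hderiv : deriv θ = ψ := funext fun x => (hd x).deriv
  refine ⟨θ, contDiff_infty_iff_deriv.2 ⟨fun x => (hd x).differentiableAt, hderiv ▸ hψ⟩,
    HasCompactSupport.intro (isCompact_Icc (a := -a) (b := a)) fun x hx => ?_, hderiv⟩
  rcases lt_or_ge x (-a) with h | h
  · have : ∀ t ∈ uIcc (-a) x, ψ t = (fun _ => (0 : ℝ)) t := fun t ht => by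
      by_contra hne
      rw [uIcc_of_ge h.le] at ht
      linarith [(ha t hne).1, ht.2]
    simp only [θ]
    rw [intervalIntegral.integral_congr this]; simp
  · have hxa : a < x := by
      by_contra hcon; exact hx ⟨h, not_lt.1 hcon⟩
    simp only [θ]
    rw [intervalIntegral.integral_of_le h,
      setIntegral_eq_integral_of_forall_compl_eq_zero (fun t ht => ?_), h0]
    by_contra hne
    exact ht ⟨(ha t hne).1, by linarith [(ha t hne).2]⟩

theorem integral_id_mul_deriv {θ : ℝ → ℝ} (hθ : ContDiff ℝ 1 θ) (hc : HasCompactSupport θ) :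
    ∫ x, x * deriv θ x = -∫ x, θ x := by
  have hcd := hθ.continuous_deriv le_rfl
  have := integral_mul_deriv_eq_deriv_mul_of_integrable (u := fun x : ℝ => x) (v := θ)
    (u' := fun _ => 1) (v' := deriv θ) (fun x _ => hasDerivAt_id' x)
    (fun x _ => (hθ.differentiable one_ne_zero x).hasDerivAt)
    ((continuous_id.mul hcd).integrable_of_hasCompactSupport hc.deriv.mul_left)
    ((continuous_const.mul hθ.continuous).integrable_of_hasCompactSupport hc.mul_left)
    ((continuous_id.mul hθ.continuous).integrable_of_hasCompactSupport hc.mul_left)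
  simpa using this

theorem exists_compactSupport_second_antideriv {ψ : ℝ → ℝ} (hψ : ContDiff ℝ ∞ ψ)
    (hc : HasCompactSupport ψ) (h0 : ∫ x, ψ x = 0) (h1 : ∫ x, x * ψ x = 0) :
    ∃ η : ℝ → ℝ, ContDiff ℝ ∞ η ∧ HasCompactSupport η ∧ deriv (deriv η) = ψ := by
  obtain ⟨θ, hθ, hθc, rfl⟩ := exists_compactSupport_antideriv hψ hc h0
  rw [integral_id_mul_deriv (hθ.of_le (WithTop.coe_le_coe.2 le_top)) hθc, neg_eq_zero] at h1
  obtain ⟨η, hη, hηc, rfl⟩ := exists_compactSupport_antideriv hθ hθc h1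
  exact ⟨η, hη, hηc, rfl⟩

/-- A locally integrable function with vanishing weak second derivative is affine. -/
theorem ae_eq_affine_of_integral_mul_deriv_deriv_eq_zero {w : ℝ → ℝ}
    (hw : LocallyIntegrable w)
    (h : ∀ η : ℝ → ℝ, ContDiff ℝ ∞ η → HasCompactSupport η → ∫ x, w x * deriv (deriv η) x = 0) :
    ∃ A B : ℝ, ∀ᵐ x, w x = A + B * x := by
  obtain ⟨χ, hχ, hχc, hχ1⟩ : ∃ χ : ℝ → ℝ, ContDiff ℝ ∞ χ ∧ HasCompactSupport χ ∧
      ∫ x, χ x = 1 := by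
    let b : ContDiffBump (0 : ℝ) := ⟨1, 2, one_pos, one_lt_two⟩
    exact ⟨b.normed volume, b.contDiff_normed, b.hasCompactSupport_normed, b.integral_normed⟩
  have hχ' : ContDiff ℝ ∞ (deriv χ) := (contDiff_infty_iff_deriv.1 hχ).2
  have hχ11 : ContDiff ℝ 1 χ := hχ.of_le (WithTop.coe_le_coe.2 le_top)
  have hI0 : ∫ x, deriv χ x = 0 := by
    have i : Integrable (deriv χ) := hχ'.continuous.integrable_of_hasCompactSupport hχc.deriv
    rw [← intervalIntegral.integral_Iic_add_Ioi i.integrableOn i.integrableOn (b := 0),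
      hχc.integral_Iic_deriv_eq hχ11, hχc.integral_Ioi_deriv_eq hχ11]
    ring
  have hI1 := integral_id_mul_deriv hχ11 hχc
  rw [hχ1] at hI1
  have iw : ∀ g : ℝ → ℝ, Continuous g → HasCompactSupport g → Integrable fun x => w x * g x :=
    fun g hg hgc => by
      simpa [mul_comm] using hw.integrable_smul_left_of_hasCompactSupport hg hgc
  have ic : ∀ g : ℝ → ℝ, Continuous g → HasCompactSupport g → Integrable g :=
    fun g hg hgc => hg.integrable_of_hasCompactSupport hgc
  have ix : ∀ g : ℝ → ℝ, Continuous g → HasCompactSupport g → Integrable fun x => x * g x :=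
    fun g hg hgc => (continuous_id.mul hg).integrable_of_hasCompactSupport hgc.mul_left
  have lin : ∀ F G H : ℝ → ℝ, Integrable F → Integrable G → Integrable H → ∀ a b : ℝ,
      ∫ x, (F x - a * G x + b * H x) = (∫ x, F x) - a * (∫ x, G x) + b * ∫ x, H x := by
    intro F G H hF hG hH a b
    have hG' : Integrable fun x => a * G x := hG.const_mul a
    have hH' : Integrable fun x => b * H x := hH.const_mul b
    have hFG : Integrable fun x => F x - a * G x := hF.sub hG'
    rw [integral_add hFG hH', integral_sub hF hG', integral_const_mul, integral_const_mul]
  set m := ∫ x, x * χ x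
  set a := ∫ x, w x * χ x
  set b := -∫ x, w x * deriv χ x with hb
  refine ⟨a - m * b, b, ?_⟩
  have hloc : LocallyIntegrable fun x => w x - ((a - m * b) + b * x) :=
    hw.sub (Continuous.locallyIntegrable (by fun_prop))
  have hz := ae_eq_zero_of_integral_contDiff_smul_eq_zero hloc fun ψ hψ hψc => by
    set m0 := ∫ x, ψ x with hm0
    set m1 := ∫ x, x * ψ x with hm1
    -- The moments of order 0 and 1 are (1, m) for χ and (0, -1) for χ'. The corrected ψ has both
    -- moments zero, hence is the second derivative of a test function.
    have hg : ContDiff ℝ ∞ fun x => ψ x - m0 * χ x + (m1 - m0 * m) * deriv χ x :=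
      (hψ.sub (contDiff_const.mul hχ)).add (contDiff_const.mul hχ')
    have hgc : HasCompactSupport fun x => ψ x - m0 * χ x + (m1 - m0 * m) * deriv χ x :=
      (hψc.sub hχc.mul_left).add hχc.deriv.mul_left
    obtain ⟨η, hη, hηc, e⟩ := exists_compactSupport_second_antideriv hg hgc
      (by
        rw [lin _ _ _ (ic _ hψ.continuous hψc) (ic _ hχ.continuous hχc)
          (ic _ hχ'.continuous hχc.deriv), hχ1, hI0, ← hm0]
        ring)
      (by
        have e : ∀ x, x * (ψ x - m0 * χ x + (m1 - m0 * m) * deriv χ x) =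
          x * ψ x - m0 * (x * χ x) + (m1 - m0 * m) * (x * deriv χ x) := fun x => by ring
        simp_rw [e]
        rw [lin _ _ _ (ix _ hψ.continuous hψc) (ix _ hχ.continuous hχc)
          (ix _ hχ'.continuous hχc.deriv), hI1, ← hm1]
        ring)
    have key := h η hη hηc
    rw [e] at key
    have e : ∀ x, w x * (ψ x - m0 * χ x + (m1 - m0 * m) * deriv χ x) =
      w x * ψ x - m0 * (w x * χ x) + (m1 - m0 * m) * (w x * deriv χ x) := fun x => by ring
    simp_rw [e] at key
    rw [lin _ _ _ (iw _ hψ.continuous hψc) (iw _ hχ.continuous hχc)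
          (iw _ hχ'.continuous hχc.deriv)] at key
    have e2 : ∀ x, ψ x • (w x - ((a - m * b) + b * x)) =
      w x * ψ x - (a - m * b) * ψ x + (-b) * (x * ψ x) := fun x => by
        rw [smul_eq_mul]; ring
    simp_rw [e2]
    rw [lin _ _ _ (iw _ hψ.continuous hψc) (ic _ hψ.continuous hψc) (ix _ hψ.continuous hψc),
      ← hm0, ← hm1]
    linear_combination key + (m1 - m0 * m) * hb
  filter_upwards [hz] with x hx
  linarith

/-! ### Affine representation of solutions -/

theorem MemLs.integrable_abs_mul {s : ℝ} (hs : s ∈ Ioo (1 / 2 : ℝ) 1) {u : ℝ → ℝ} (hu : MemLs s u) :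
    Integrable fun x => |u x| * (1 + |x|) ^ (-1 - 2 * s) := by
  have hs0 : 0 < s := by linarith [hs.1]
  have hm : AEStronglyMeasurable fun x => |u x| * (1 + |x|) ^ (-1 - 2 * s) :=
    hu.1.aestronglyMeasurable.norm.mul
      (by fun_prop : Measurable fun x : ℝ => (1 + |x|) ^ (-1 - 2 * s)).aestronglyMeasurable
  refine (hu.2.const_mul 2).mono' hm (Eventually.of_forall fun x => ?_)
  have h1 : 1 ≤ (1 + |x|) ^ (1 + 2 * s) :=
    Real.one_le_rpow (by linarith [abs_nonneg x]) (by linarith)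
  have h2 : |x| ^ (1 + 2 * s) ≤ (1 + |x|) ^ (1 + 2 * s) :=
    Real.rpow_le_rpow (abs_nonneg x) (by linarith) (by linarith)
  have h3 : 0 < 1 + |x| ^ (1 + 2 * s) := by positivity
  rw [Real.norm_of_nonneg (by positivity), show -1 - 2 * s = -(1 + 2 * s) by ring,
    Real.rpow_neg (by positivity), mul_div_assoc', mul_comm 2 |u x|, mul_div_assoc]
  refine mul_le_mul_of_nonneg_left ?_ (abs_nonneg _)
  rw [inv_eq_one_div, div_le_div_iff₀ (by positivity) h3]
  linarith

theorem integrable_abs_greenPotential_mul {s : ℝ} (hs : s ∈ Ioo (1 / 2 : ℝ) 1) {ρ : ℝ → ℝ}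
    (hρ : Integrable ρ) :
    Integrable fun x => |greenPotential s ρ x| * (1 + |x|) ^ (-1 - 2 * s) := by
  refine ((integrable_one_add_abs_rpow_mul_rpow (2 * s)).const_mul
    (|greenConst (s - 1 / 2)| * ∫ y, ‖ρ y‖)).mono'
    ((aestronglyMeasurable_greenPotential hs hρ).norm.mul
      (by fun_prop : Measurable fun x : ℝ => (1 + |x|) ^ (-1 - 2 * s)).aestronglyMeasurable)
    (Eventually.of_forall fun x => ?_)
  rw [Real.norm_of_nonneg (by positivity), ← mul_assoc]
  refine mul_le_mul_of_nonneg_right ((abs_greenPotential_le hs hρ x).trans ?_) (by positivity)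
  refine mul_le_mul_of_nonneg_left ?_
    (mul_nonneg (abs_nonneg _) (integral_nonneg fun _ => norm_nonneg _))
  exact Real.rpow_le_rpow (abs_nonneg x) (by linarith) (by linarith [hs.1])

theorem locallyIntegrable_greenPotential {s : ℝ} (hs : s ∈ Ioo (1 / 2 : ℝ) 1) {ρ : ℝ → ℝ}
    (hρ : Integrable ρ) : LocallyIntegrable (greenPotential s ρ) := by
  have hc : Continuous fun x : ℝ =>
      |greenConst (s - 1 / 2)| * (∫ y, ‖ρ y‖) * |x| ^ (2 * s - 1) :=
    (continuous_abs_rpow (by linarith [hs.1])).const_mul _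
  refine hc.locallyIntegrable.mono (aestronglyMeasurable_greenPotential hs hρ)
    (Eventually.of_forall fun x => ?_)
  exact (abs_greenPotential_le hs hρ x).trans (Real.le_norm_self _)

theorem integrable_mul_singLap {p : ℝ} (hp : 1 < p) (hp2 : p < 2) {w : ℝ → ℝ}
    (hwm : AEStronglyMeasurable w) (hw : Integrable fun x => |w x| * (1 + |x|) ^ (-1 - p))
    {φ : ℝ → ℝ} (hφ : ContDiff ℝ 2 φ) (hc : HasCompactSupport φ) :
    Integrable fun x => w x * singLap p φ x := by
  obtain ⟨C, hC0, hC⟩ := exists_abs_singLap_le hp hp2 hφ hc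
  refine (hw.const_mul C).mono' (hwm.mul
    (continuous_singLap_of_hasCompactSupport hp hp2 hφ hc).aestronglyMeasurable)
    (Eventually.of_forall fun x => ?_)
  rw [norm_mul, Real.norm_eq_abs, Real.norm_eq_abs]
  calc |w x| * |singLap p φ x| ≤ |w x| * (C * (1 + |x|) ^ (-1 - p)) :=
        mul_le_mul_of_nonneg_left (hC x) (abs_nonneg _)
    _ = _ := by ring

theorem fracLapConst_ne_zero {s : ℝ} (hs : s ∈ Ioo (1 / 2 : ℝ) 1) : fracLapConst s ≠ 0 := by
  intro h
  have := neg_greenConst_mul_fracLapConst hs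
  rw [h] at this
  simp at this

/-- Both u and the potential of ρ are weighted integrable and solve the same equation, so
Liouville's theorem applies to their difference. -/
theorem exists_hasAffineRepr {s : ℝ} (hs : s ∈ Ioo (1 / 2 : ℝ) 1) {u ρ : ℝ → ℝ}
    (hu : MemLs s u) (hρ : Integrable ρ) (hsol : SolvesFracLap s u ρ) :
    ∃ A B, HasAffineRepr s u ρ A B := by
  have hp : 1 < 2 * s := by linarith [hs.1]
  have hp2 : 2 * s < 2 := by linarith [hs.2]
  have hvm := aestronglyMeasurable_greenPotential hs hρ
  have hum := hu.1.aestronglyMeasurable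
  have iu := hu.integrable_abs_mul hs
  have iv := integrable_abs_greenPotential_mul hs hρ
  set w : ℝ → ℝ := fun x => u x - greenPotential s ρ x with hw
  have hwm : AEStronglyMeasurable w := hum.sub hvm
  have iw : Integrable fun x => |w x| * (1 + |x|) ^ (-1 - 2 * s) := by
    refine (iu.add iv).mono' (hwm.norm.mul
      (by fun_prop : Measurable fun x : ℝ => (1 + |x|) ^ (-1 - 2 * s)).aestronglyMeasurable)
      (Eventually.of_forall fun x => ?_)
    rw [Real.norm_of_nonneg (by positivity), Pi.add_apply, ← add_mul]
    exact mul_le_mul_of_nonneg_right (abs_sub _ _) (by positivity)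
  have hzero : ∀ φ : ℝ → ℝ, ContDiff ℝ ∞ φ → HasCompactSupport φ →
      ∫ x, w x * singLap (2 * s) φ x = 0 := by
    intro φ hφ hc
    have hφ2 : ContDiff ℝ 2 φ := hφ.of_le (WithTop.coe_le_coe.2 le_top)
    have e := (hsol φ hφ hc).trans (solvesFracLap_greenPotential hs hρ φ hφ hc).symm
    simp_rw [fracLap_eq hs hφ2 hc, mul_left_comm _ (fracLapConst s)] at e
    rw [integral_const_mul, integral_const_mul] at e
    have e' := mul_left_cancel₀ (fracLapConst_ne_zero hs) e
    simp_rw [hw, sub_mul]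
    rw [integral_sub (integrable_mul_singLap hp hp2 hum iu hφ2 hc)
      (integrable_mul_singLap hp hp2 hvm iv hφ2 hc), e', sub_self]
  obtain ⟨A, B, h⟩ := ae_eq_affine_of_integral_mul_deriv_deriv_eq_zero
    (hu.1.sub (locallyIntegrable_greenPotential hs hρ))
    (fun η hη hc => integral_mul_deriv_deriv_eq_zero hp hp2 hwm iw hzero hη hc)
  refine ⟨A, B, ?_⟩
  filter_upwards [h] with x hx
  have : u x - greenPotential s ρ x = A + B * x := hx
  linarith

/-! ### Vanishing slope, growth and conclusion -/

theorem exists_mul_rpow_le_add {q : ℝ} (hq0 : 0 < q) (hq : q < 1) {D ε : ℝ} (hD : 0 ≤ D)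
    (hε : 0 < ε) : ∃ C, ∀ x : ℝ, D * |x| ^ q ≤ ε * |x| + C := by
  -- T is the crossover point D T^q = ε T; beyond it the linear term wins.
  set T := (D / ε) ^ (1 - q)⁻¹ with hT
  have hT0 : 0 ≤ T := by positivity
  refine ⟨D * T ^ q, fun x => ?_⟩
  rcases le_or_gt |x| T with h | h
  · have : D * |x| ^ q ≤ D * T ^ q := by gcongr
    have : 0 ≤ ε * |x| := by positivity
    linarith
  · have hx : 0 < |x| := hT0.trans_lt h
    have h1 : D / ε ≤ |x| ^ (1 - q) := by
      calc D / ε = T ^ (1 - q) := by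
            rw [hT, ← Real.rpow_mul (by positivity), inv_mul_cancel₀ (by linarith), Real.rpow_one]
        _ ≤ |x| ^ (1 - q) := Real.rpow_le_rpow hT0 h.le (by linarith)
    rw [div_le_iff₀ hε] at h1
    have h2 : D * |x| ^ q ≤ ε * |x| := by
      calc D * |x| ^ q ≤ |x| ^ (1 - q) * ε * |x| ^ q := by gcongr
        _ = ε * (|x| ^ (1 - q) * |x| ^ q) := by ring
        _ = ε * |x| := by rw [← Real.rpow_add hx, sub_add_cancel, Real.rpow_one]
    have : 0 ≤ D * T ^ q := by positivity
    linarith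

theorem HasAffineRepr.slope_eq_zero {s : ℝ} (hs : s ∈ Ioo (1 / 2 : ℝ) 1) {K u ρ : ℝ → ℝ}
    (hKm : AEMeasurable K) (hKe : ∀ x, K (-x) = K x) (hK0 : ∀ x, 0 ≤ K x)
    (hK : ∀ μ : ℝ, 0 < μ → ¬ Integrable (fun x : ℝ => Real.exp (μ * |x|) * K x))
    (hi : Integrable fun x => K x * Real.exp (u x)) (hρ : Integrable ρ) {A B : ℝ}
    (h : HasAffineRepr s u ρ A B) : B = 0 := by
  by_contra hB
  -- Half of the slope absorbs the sublinear potential; the other half survives as the exponential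
  -- rate μ.
  have hB0 : 0 < |B| / 2 := by positivity
  have hI : 0 ≤ ∫ y, ‖ρ y‖ := integral_nonneg fun _ => norm_nonneg _
  obtain ⟨C, hC⟩ := exists_mul_rpow_le_add (q := 2 * s - 1) (by linarith [hs.1])
    (by linarith [hs.2]) (D := |greenConst (s - 1 / 2)| * ∫ y, ‖ρ y‖) (by positivity) hB0
  have hlow : ∀ᵐ x, 0 ≤ B * x → |B| / 2 * |x| ≤ u x + (C + |A|) := by
    filter_upwards [h] with x hx hBx
    have h1 := (neg_abs_le (greenPotential s ρ x))
    have h2 := abs_greenPotential_le hs hρ x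
    have h3 := hC x
    have h4 : B * x = |B| * |x| := by rw [← abs_mul, abs_of_nonneg hBx]
    have h5 := neg_abs_le A
    rw [hx, h4]; linarith
  have hlow' : ∀ᵐ x, 0 ≤ B * -x → |B| / 2 * |-x| ≤ u (-x) + (C + |A|) :=
    (Measure.measurePreserving_neg (volume : Measure ℝ)).quasiMeasurePreserving.ae hlow
  refine hK _ hB0 ?_
  have hi' : Integrable fun x => K (-x) * Real.exp (u (-x)) := hi.comp_neg
  refine ((hi.add hi').const_mul (Real.exp (C + |A|))).mono'
    ((by fun_prop : Measurable fun x : ℝ => Real.exp (|B| / 2 * |x|)).aestronglyMeasurable.mul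
      hKm.aestronglyMeasurable) ?_
  filter_upwards [hlow, hlow'] with x h1 h2
  have hKx := hK0 x
  rw [Real.norm_of_nonneg (by positivity), Pi.add_apply, hKe]
  -- At least one of x and -x lies in the half-line where the lower bound holds, so adding both
  -- exponentials covers every x; evenness of K then returns integrability.
  have key : Real.exp (|B| / 2 * |x|) ≤
      Real.exp (C + |A|) * Real.exp (u x) + Real.exp (C + |A|) * Real.exp (u (-x)) := by
    rw [← Real.exp_add, ← Real.exp_add]
    rcases le_total 0 (B * x) with hx | hx
    · have := Real.exp_le_exp.2 (h1 hx)
      rw [add_comm (u x)] at this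
      linarith [Real.exp_pos (C + |A| + u (-x))]
    · have := Real.exp_le_exp.2 (h2 (by linarith))
      rw [add_comm (u (-x)), abs_neg] at this
      linarith [Real.exp_pos (C + |A| + u x)]
  calc _ ≤ (Real.exp (C + |A|) * Real.exp (u x) + Real.exp (C + |A|) * Real.exp (u (-x))) * K x :=
        mul_le_mul_of_nonneg_right key hKx
    _ = _ := by ring

theorem HasAffineRepr.aeBigOPow {s : ℝ} (hs : s ∈ Ioo (1 / 2 : ℝ) 1) {u ρ : ℝ → ℝ}
    (hρ : Integrable ρ) {A : ℝ} (h : HasAffineRepr s u ρ A 0) : AEBigOPow u (2 * s - 1) := by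
  -- The radius 1 ensures |x|^(2s-1) ≥ 1, which lets the constant A be absorbed.
  refine ⟨|greenConst (s - 1 / 2)| * (∫ y, ‖ρ y‖) + |A|, 1, one_pos, ?_⟩
  filter_upwards [h] with x hx h1
  have h2 : 1 ≤ |x| ^ (2 * s - 1) := Real.one_le_rpow h1 (by linarith [hs.1])
  rw [hx, zero_mul, add_zero, add_mul]
  exact (abs_add_le _ _).trans (add_le_add (abs_greenPotential_le hs hρ x)
    (le_mul_of_one_le_right (abs_nonneg _) h2))

theorem proposition1p8 (s : ℝ) (hs : s ∈ Set.Ioo (1 / 2 : ℝ) 1) :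
    (∀ K : ℝ → ℝ, AEMeasurable K volume →
      (∀ x, K (-x) = K x) → (∀ x, 0 ≤ K x) →
      (∀ μ : ℝ, 0 < μ → ¬ Integrable (fun x : ℝ => Real.exp (μ * |x|) * K x) volume) →
      ∀ u : ℝ → ℝ, MemLs s u →
        Integrable (fun x => K x * Real.exp (u x)) volume →
        SolvesFracLap s u (fun x => K x * Real.exp (u x)) →
        IsIntegralSolution s u (fun x => K x * Real.exp (u x)) ∧
          (∃ A : ℝ, HasAffineRepr s u (fun x => K x * Real.exp (u x)) A 0) ∧
          (∀ A B : ℝ, HasAffineRepr s u (fun x => K x * Real.exp (u x)) A B → B = 0)) ∧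
    (∀ u : ℝ → ℝ, MemLs s u →
      Integrable (fun x => Real.exp (u x)) volume →
      SolvesFracLap s u (fun x => Real.exp (u x)) →
      IsIntegralSolution s u (fun x => Real.exp (u x)) ∧
        (∃ A : ℝ, HasAffineRepr s u (fun x => Real.exp (u x)) A 0) ∧
        (∀ A B : ℝ, HasAffineRepr s u (fun x => Real.exp (u x)) A B → B = 0)) := by
  have main : ∀ K : ℝ → ℝ, AEMeasurable K volume →
      (∀ x, K (-x) = K x) → (∀ x, 0 ≤ K x) →
      (∀ μ : ℝ, 0 < μ → ¬ Integrable (fun x : ℝ => Real.exp (μ * |x|) * K x) volume) →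
      ∀ u : ℝ → ℝ, MemLs s u →
        Integrable (fun x => K x * Real.exp (u x)) volume →
        SolvesFracLap s u (fun x => K x * Real.exp (u x)) →
        IsIntegralSolution s u (fun x => K x * Real.exp (u x)) ∧
          (∃ A : ℝ, HasAffineRepr s u (fun x => K x * Real.exp (u x)) A 0) ∧
          (∀ A B : ℝ, HasAffineRepr s u (fun x => K x * Real.exp (u x)) A B → B = 0) := by
    intro K hKm hKe hK0 hK u hu hi hsol
    obtain ⟨A, B, h⟩ := exists_hasAffineRepr hs hu hi hsol
    have hB : ∀ A B : ℝ, HasAffineRepr s u (fun x => K x * Real.exp (u x)) A B → B = 0 :=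
      fun A B h => h.slope_eq_zero hs hKm hKe hK0 hK hi hi
    obtain rfl := hB A B h
    exact ⟨⟨hu, hi, hsol, h.aeBigOPow hs hi⟩, ⟨A, h⟩, hB⟩
  refine ⟨main, fun u hu hi hsol => ?_⟩
  have h1 : ∀ μ : ℝ, 0 < μ → ¬ Integrable (fun x : ℝ => Real.exp (μ * |x|) * 1) volume := by
    intro μ hμ hint
    have hone : Integrable (fun _ : ℝ => (1 : ℝ)) volume :=
      hint.mono' aestronglyMeasurable_const (Eventually.of_forall fun x => by
        rw [norm_one, mul_one]
        exact Real.one_le_exp (by positivity))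
    rw [integrable_const_iff] at hone
    simp [isFiniteMeasure_iff] at hone
  have := main (fun _ => 1) aemeasurable_const (fun _ => rfl) (fun _ => zero_le_one) h1 u hu
  simp only [one_mul] at this
  exact this hi hsol
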